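/- Identify elliptic curves over $\mathbb{Q}$ (up to isomorphism) with the curves $E_{A,B}: y^2=x^3+Ax+B$, where $A,B\in\mathbb{Z}$, $4A^3+27B^2\neq 0$, and there is no prime $p$ with $p^4\mid A$ and $p^6\mid B$. Put $I(E_{A,B})=-3A$, $J(E_{A,B})=-27B$, $\Delta(I,J)=(4I^3-J^2)/27$, and let $$h_e(E_{A,B})=h_e(I,J)=\max\{|I|/3,\ |J|/27\}.$$ For each prime $p$ let $\Sigma_p$ be a relatively closed subset of $\{(I,J)\in\mathbb{Z}_p^2:\Delta(I,J)\neq 0\}$ whose boundary has measure zero, and let $\Sigma_\infty\subset\mathbb{R}^2$ be one of $\{\Delta>0\}$, $\{\Delta<0\}$, $\{\Delta\ne0\}$. The set $F$ of all elliptic curves $E$ with $(I(E),J(E))\in\Sigma_p$ for every prime $p$ and $(I(E),J(E))\in\Sigma_\infty$ is called a family defined by congruence conditions. For such a nonempty family $F$, let $\mathrm{Inv}(F)=\{(I(E),J(E)):E\in F\}$; let $\mathrm{Inv}_p(F)$ be the set of $(I,J)$ with $\Delta(I,J)\ne 0$ in the closure of $\mathrm{Inv}(F)$ in $\mathbb{Z}_p^2$;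 and let $\mathrm{Inv}_\infty(F)\subset\mathbb{R}^2$ be $\{\Delta>0\}$, $\{\Delta<0\}$ or $\{\Delta\neq0\}$ according to whether $F$ contains only curves with $\Delta(I(E),J(E))>0$, only curves with $\Delta(I(E),J(E))<0$, or both. The family $F$ is large if, for all but finitely many primes $p$, $\mathrm{Inv}_p(F)$ contains every $(I,J)\in\mathbb{Z}_p^2$ with $p^2\nmid\Delta(I,J)$. Set $$M_p(F)=\int_{\mathrm{Inv}_p(F)}dI\,dJ,\qquad M_\infty(F;X)=\int_{(I,J)\in\mathrm{Inv}_\infty(F),\ h_e(I,J)<X}dI\,dJ,$$ with Haar measure of total mass $1$ on $\mathbb{Z}_p^2$ and Lebesgue measure on $\mathbb{R}^2$. Theorem. Let $F$ be a large family of elliptic curves and let $N(F;X)$ be the number of $E\in F$ with $h_e(E)<X$. Then the product $\prod_p M_p(F)$ over all primes converges (unconditionally, the value $0$ being allowed), and as $X\to\infty$ $$N(F;X)=M_\infty(F;X)\prod_p M_p(F)+o(X^2).$$ -/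

import Mathlib

open MeasureTheory Filter Asymptotics

namespace LargeFamily

/-- The curve `y² = x³ + A x + B` over `ℚ`. -/
def shortWeierstrass (A B : ℤ) : WeierstrassCurve ℚ where
  a₁ := 0
  a₂ := 0
  a₃ := 0
  a₄ := A
  a₆ := B

/-- The elliptic curves `E_{A,B} : y² = x³ + A x + B` with `A, B ∈ ℤ` such that no prime `p`
satisfies both `p⁴ ∣ A` and `p⁶ ∣ B`.  Every elliptic curve over `ℚ` is isomorphic to exactly one
of them, so that this is the set of elliptic curves over `ℚ`. -/
@[ext]
structure EllCurve where
  A : ℤ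
  B : ℤ
  isElliptic : (shortWeierstrass A B).IsElliptic
  minimal : ∀ p : ℕ, p.Prime → (p : ℤ) ^ 6 ∣ B → ¬ (p : ℤ) ^ 4 ∣ A

/-- The invariant `I(E_{A,B}) = -3A`. -/
def EllCurve.I (E : EllCurve) : ℤ := -3 * E.A

/-- The invariant `J(E_{A,B}) = -27B`. -/
def EllCurve.J (E : EllCurve) : ℤ := -27 * E.B

/-- The discriminant `Δ(I, J) = (4 I³ - J²) / 27`. -/
def disc {K : Type*} [Field K] (I J : K) : K := (4 * I ^ 3 - J ^ 2) / 27

/-- The height `h_e(I, J) = max {|I| / 3, |J| / 27}`. -/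
noncomputable def heightIJ (I J : ℝ) : ℝ := max (|I| / 3) (|J| / 27)

/-- The height `h_e(E)`. -/
noncomputable def EllCurve.height (E : EllCurve) : ℝ := heightIJ E.I E.J

instance factPrime (p : Nat.Primes) : Fact (p : ℕ).Prime := ⟨p.2⟩

section Local

variable (p : ℕ) [Fact p.Prime]

noncomputable instance padicIntMeasurableSpace : MeasurableSpace ℤ_[p] := borel _

instance padicIntBorelSpace : BorelSpace ℤ_[p] := ⟨rfl⟩

/-- The Haar measure `dI dJ` on `ℤ_p × ℤ_p` of total mass `1`. -/
noncomputable def padicPlaneMeasure : Measure (ℤ_[p] × ℤ_[p]) :=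
  (Measure.addHaarMeasure (⊤ : TopologicalSpace.PositiveCompacts ℤ_[p])).prod
    (Measure.addHaarMeasure (⊤ : TopologicalSpace.PositiveCompacts ℤ_[p]))

/-- The discriminant of a pair of `p`-adic integers, as an element of `ℚ_p`. -/
noncomputable def padicDisc (x : ℤ_[p] × ℤ_[p]) : ℚ_[p] := disc (x.1 : ℚ_[p]) (x.2 : ℚ_[p])

/-- A local condition at `p`: a subset of `ℤ_p² ∖ {Δ = 0}` that is closed in
`ℤ_p² ∖ {Δ = 0}` and whose boundary has measure zero. -/
structure IsLocalCondition (S : Set (ℤ_[p] × ℤ_[p])) : Prop where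
  disc_ne_zero : ∀ x ∈ S, padicDisc p x ≠ 0
  closed : ∃ C : Set (ℤ_[p] × ℤ_[p]), IsClosed C ∧ S = C ∩ {x | padicDisc p x ≠ 0}
  frontier_null : padicPlaneMeasure p (frontier S) = 0

/-- The pair `(I(E), J(E))` in `ℤ_p²`. -/
noncomputable def EllCurve.padicInv (E : EllCurve) : ℤ_[p] × ℤ_[p] := ((E.I : ℤ_[p]), (E.J : ℤ_[p]))

/-- `Inv_p(F)`: the pairs with `Δ ≠ 0` in the `p`-adic closure of
`{(I(E), J(E)) : E ∈ F}`. -/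
def invAt (F : Set EllCurve) : Set (ℤ_[p] × ℤ_[p]) :=
  closure ((fun E => E.padicInv p) '' F) ∩ {x | padicDisc p x ≠ 0}

/-- The local mass `M_p(F)`. -/
noncomputable def localMass (F : Set EllCurve) : ℝ := (padicPlaneMeasure p).real (invAt p F)

end Local

/-- The three possible conditions at infinity. -/
def IsInfinityCondition (S : Set (ℝ × ℝ)) : Prop :=
  S = {x | 0 < disc x.1 x.2} ∨ S = {x | disc x.1 x.2 < 0} ∨ S = {x | disc x.1 x.2 ≠ 0}

/-- The pair `(I(E), J(E))` in `ℝ²`. -/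
def EllCurve.realInv (E : EllCurve) : ℝ × ℝ := ((E.I : ℝ), (E.J : ℝ))

/-- A family of elliptic curves defined by congruence conditions (including a condition at
infinity; `{Δ ≠ 0}` imposes nothing there). -/
def IsCongruenceFamily (F : Set EllCurve) : Prop :=
  ∃ (S : ∀ p : Nat.Primes, Set (ℤ_[p] × ℤ_[p])) (Sinf : Set (ℝ × ℝ)),
    (∀ p : Nat.Primes, IsLocalCondition p (S p)) ∧ IsInfinityCondition Sinf ∧
    F = {E | (∀ p : Nat.Primes, E.padicInv p ∈ S p) ∧ E.realInv ∈ Sinf}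

/-- A large family: a nonempty family defined by congruence conditions such that, for all but
finitely many primes `p`, every `(I, J) ∈ ℤ_p²` with `p² ∤ Δ(I, J)` lies in `Inv_p(F)`. -/
structure IsLargeFamily (F : Set EllCurve) : Prop where
  nonempty : F.Nonempty
  congruence : IsCongruenceFamily F
  large : ∀ᶠ p : Nat.Primes in cofinite, ∀ x : ℤ_[p] × ℤ_[p],
    (¬ ∃ d : ℤ_[p], padicDisc p x = (p : ℚ_[p]) ^ 2 * d) → x ∈ invAt p F

/-- `Inv_∞(F)`: the set `{Δ > 0}`, `{Δ < 0}` or `{Δ ≠ 0}` according to whether `F` contains curves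
of positive discriminant, of negative discriminant, or both. -/
def invInfinity (F : Set EllCurve) : Set (ℝ × ℝ) :=
  {x | (0 < disc x.1 x.2 ∧ ∃ E ∈ F, 0 < disc (E.I : ℝ) (E.J : ℝ)) ∨
    (disc x.1 x.2 < 0 ∧ ∃ E ∈ F, disc (E.I : ℝ) (E.J : ℝ) < 0)}

/-- `M_∞(F; X)`: the area of the part of `Inv_∞(F)` of height less than `X`. -/
noncomputable def massInfinity (F : Set EllCurve) (X : ℝ) : ℝ :=
  (volume : Measure (ℝ × ℝ)).real {x | x ∈ invInfinity F ∧ heightIJ x.1 x.2 < X}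

/-- `N(F; X)`: the number of elliptic curves in `F` of height less than `X`. -/
noncomputable def count (F : Set EllCurve) (X : ℝ) : ℕ := {E ∈ F | E.height < X}.ncard

/-- The sets counted by `count` are finite. -/
theorem finite_height_lt (F : Set EllCurve) (X : ℝ) : {E ∈ F | E.height < X}.Finite := by
  have hfin : ((Set.Icc (-⌈X⌉) ⌈X⌉) ×ˢ (Set.Icc (-⌈X⌉) ⌈X⌉) : Set (ℤ × ℤ)).Finite :=
    (Set.finite_Icc _ _).prod (Set.finite_Icc _ _)
  refine Set.Finite.of_finite_image (f := fun E : EllCurve => (E.A, E.B))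
    (hfin.subset ?_) ?_
  · rintro _ ⟨E, ⟨-, hE⟩, rfl⟩
    have hX := Int.le_ceil X
    simp only [EllCurve.height, heightIJ, EllCurve.I, EllCurve.J, max_lt_iff] at hE
    obtain ⟨h1, h2⟩ := hE
    push_cast at h1 h2
    rw [abs_mul] at h1 h2
    norm_num at h1 h2
    have h1' : |(E.A : ℝ)| < ⌈X⌉ := by linarith
    have h2' : |(E.B : ℝ)| < ⌈X⌉ := by linarith
    have h3 : |E.A| < ⌈X⌉ := by exact_mod_cast h1'
    have h4 : |E.B| < ⌈X⌉ := by exact_mod_cast h2'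
    rw [abs_lt] at h3 h4
    simp only [Set.mem_prod, Set.mem_Icc]
    omega
  · intro E _ E' _ h
    simp only [Prod.mk.injEq] at h
    exact EllCurve.ext h.1 h.2

end LargeFamily

namespace LargeFamily

open scoped Topology

/-! The bounds |I| < 3X and |J| < 27X are both linear in X, so J² is negligible against I³: outside
a set of density zero the sign of 4I³ - J² is the sign of I. Each sign of the discriminant therefore
takes up half of the box, with area 162X² + o(X²), and the two signs can be counted separately.
Curves of F with a permitted sign are the integer pairs of that sign lying, for every p, in the set
W_p of pairs that satisfy the condition at p and are p-minimal (`exists_ellCurve_of_forall_mem`).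

For finitely many primes the density of such pairs is the product of the measures of the W_p: a set
with null boundary is approximated by residue discs, and the Chinese remainder theorem makes
different primes independent (`tendsto_pointDensity_forall_mem_finset`). To reach all primes, the
points failing some W_p with p > M must be few, uniformly in X. Largeness turns such a failure into
p² ∣ 4I³ - J², and `exists_card_large_square_divisor_le` bounds these points. Primes dividing both
coordinates, and primes up to a multiple LY of the side, are handled by congruences modulo p or p²
and by π(LY) = o(Y). For p > LY the cofactor m in 4a³ - b² = ±mp² is small, and mp² lies so close to
4|a|³ that few p are possible for each a and m.

The theorem speaks of the closures Inv_p(F), not of W_p. Always Inv_p(F) ⊆ W_p. If the product of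
the measures of the W_p is positive, the sieve with one W_p replaced by a small disc inside it still
finds a curve, so Inv_p(F) contains the interior of W_p and has the same measure; likewise every
sign permitted at infinity occurs in F. If that product is zero, so is the product of the M_p(F),
and the count is o(X²). -/

/-! ### Integers of an interval in residue classes. -/

theorem abs_card_Ioc_modEq_sub_le {a b : ℤ} (hab : a ≤ b) {n : ℕ} (hn : 0 < n) (v : ℤ) :
    |(((Finset.Ioc a b).filter (fun x => x ≡ v [ZMOD n])).card : ℝ) - ((b : ℝ) - a) / n| ≤ 1 := by
  have h := Int.Ioc_filter_modEq_card a b (r := (n : ℤ)) (by exact_mod_cast hn) v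
  have hnR : (0 : ℚ) < n := by exact_mod_cast hn
  have hle : ((a : ℚ) - v) / n ≤ ((b : ℚ) - v) / n := by
    have : (a : ℚ) ≤ b := by exact_mod_cast hab
    gcongr
  rw [max_eq_left (by push_cast; have := Int.floor_le_floor hle; linarith)] at h
  have e : ((b : ℚ) - v) / n - ((a : ℚ) - v) / n = ((b : ℚ) - a) / n := by ring
  have h1 := Int.floor_le (((b : ℚ) - v) / n)
  have h2 := Int.lt_floor_add_one (((b : ℚ) - v) / n)
  have h3 := Int.floor_le (((a : ℚ) - v) / n)
  have h4 := Int.lt_floor_add_one (((a : ℚ) - v) / n)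
  have hq : |(((Finset.Ioc a b).filter (fun x => x ≡ v [ZMOD n])).card : ℚ)
      - ((b : ℚ) - a) / n| ≤ 1 := by
    have h' : (((Finset.Ioc a b).filter (fun x => x ≡ v [ZMOD n])).card : ℚ) =
      (⌊((b : ℚ) - v) / n⌋ : ℚ) - (⌊((a : ℚ) - v) / n⌋ : ℚ) := by
      have := congrArg (fun z : ℤ => (z : ℚ)) h
      push_cast at this
      exact this
    rw [h', ← e, abs_le]
    constructor <;> linarith
  exact_mod_cast hq

/-- The integers of absolute value at most `Y`. -/
noncomputable abbrev symmInterval (Y : ℕ) : Finset ℤ := Finset.Icc (-(Y : ℤ)) Y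

/-- The lattice points of the square `[-Y, Y]²`. -/
noncomputable abbrev square (Y : ℕ) : Finset (ℤ × ℤ) := symmInterval Y ×ˢ symmInterval Y

theorem card_symmInterval (Y : ℕ) : (symmInterval Y).card = 2 * Y + 1 := by
  rw [Int.card_Icc]; omega

theorem card_symmInterval_modEq_le (Y : ℕ) {n : ℕ} (hn : 0 < n) (v : ℤ) :
    (((symmInterval Y).filter (fun x => x ≡ v [ZMOD n])).card : ℝ) ≤ (2 * Y + 1) / n + 1 := by
  have h := abs_card_Ioc_modEq_sub_le (a := -(Y : ℤ) - 1) (b := Y) (by omega) hn v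
  have e : Finset.Ioc (-(Y : ℤ) - 1) Y = symmInterval Y := by
    ext x; simp only [Finset.mem_Ioc, Finset.mem_Icc]; omega
  rw [e] at h
  have := (abs_le.1 h).2
  push_cast at this
  have e2 : ((Y : ℝ) - (-Y - 1)) / n = (2 * Y + 1) / n := by ring
  linarith

theorem card_filter_sq_eq_le (s : Finset ℤ) (v : ℤ) :
    (s.filter (fun b => b ^ 2 = v)).card ≤ 2 := by
  rcases (s.filter (fun b => b ^ 2 = v)).eq_empty_or_nonempty with h | ⟨b, hb⟩
  · simp [h]
  · refine (Finset.card_le_card (t := {b, -b}) fun x hx => ?_).trans Finset.card_le_two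
    simp only [Finset.mem_filter] at hb hx
    simp only [Finset.mem_insert, Finset.mem_singleton]
    exact sq_eq_sq_iff_eq_or_eq_neg.1 (hx.2.trans hb.2.symm)

/-- A square root modulo `p²` of a unit is unique up to sign. -/
theorem card_sq_modEq_le (Y : ℕ) {p : ℕ} (hp : p.Prime) (hp2 : 2 < p) {v : ℤ}
    (hv : ¬ (p : ℤ) ∣ v) :
    (((symmInterval Y).filter (fun b => (p : ℤ) ^ 2 ∣ v - b ^ 2)).card : ℝ) ≤
      2 * ((2 * Y + 1) / p ^ 2 + 1) := by
  have hpp : Prime (p : ℤ) := Nat.prime_iff_prime_int.1 hp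
  rcases ((symmInterval Y).filter
    (fun b => (p : ℤ) ^ 2 ∣ v - b ^ 2)).eq_empty_or_nonempty with h | ⟨b, hb⟩
  · rw [h]; simp only [Finset.card_empty, Nat.cast_zero]; positivity
  · rw [Finset.mem_filter] at hb
    have hsub : (symmInterval Y).filter (fun b => (p : ℤ) ^ 2 ∣ v - b ^ 2) ⊆
        (symmInterval Y).filter (fun x => x ≡ b [ZMOD (p ^ 2 : ℕ)]) ∪
        (symmInterval Y).filter (fun x => x ≡ -b [ZMOD (p ^ 2 : ℕ)]) := by
      intro x hx
      rw [Finset.mem_filter] at hx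
      simp only [Finset.mem_union, Finset.mem_filter, hx.1, true_and]
      have hdiv : (p : ℤ) ^ 2 ∣ (b - x) * (b + x) := by
        rw [show (b - x) * (b + x) = (v - x ^ 2) - (v - b ^ 2) by ring]
        exact dvd_sub hx.2 hb.2
      have hbp : ¬ (p : ℤ) ∣ b := fun h => hv (by
        have h1 : (p : ℤ) ∣ v - b ^ 2 := (dvd_pow_self _ two_ne_zero).trans hb.2
        have h2 : (p : ℤ) ∣ b ^ 2 := h.trans (dvd_pow_self _ two_ne_zero)
        simpa using dvd_add h1 h2)
      -- As p is odd and prime to b, it cannot divide both factors of (b - x)(b + x), so p² divides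
      -- one of them.
      have h2b : ¬ ((p : ℤ) ∣ b - x ∧ (p : ℤ) ∣ b + x) := by
        rintro ⟨h1, h2⟩
        have h3 : (p : ℤ) ∣ 2 * b := by
          rw [show 2 * b = (b - x) + (b + x) by ring]
          exact dvd_add h1 h2
        rcases hpp.dvd_or_dvd h3 with h | h
        · have := Int.le_of_dvd (by norm_num) h; omega
        · exact hbp h
      by_cases hc : (p : ℤ) ∣ b - x
      · left
        rw [Int.modEq_iff_dvd]; push_cast
        have hcop : IsCoprime ((p : ℤ) ^ 2) (b + x) :=
          ((hpp.coprime_iff_not_dvd).2 fun h => h2b ⟨hc, h⟩).pow_left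
        exact hcop.dvd_of_dvd_mul_right hdiv
      · right
        rw [Int.modEq_iff_dvd]; push_cast
        have hcop : IsCoprime ((p : ℤ) ^ 2) (b - x) :=
          ((hpp.coprime_iff_not_dvd).2 hc).pow_left
        have := hcop.dvd_of_dvd_mul_left hdiv
        rwa [show -b - x = -(b + x) by ring, dvd_neg]
    have h1 := card_symmInterval_modEq_le Y (n := p ^ 2) (pow_pos hp.pos 2) b
    have h2 := card_symmInterval_modEq_le Y (n := p ^ 2) (pow_pos hp.pos 2) (-b)
    have h3 := Nat.cast_le (α := ℝ).2
      ((Finset.card_le_card hsub).trans (Finset.card_union_le _ _))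
    push_cast at h1 h2 h3
    linarith

/-! ### Tail estimate: large square divisors of 4a³ - b². -/

open scoped Classical in
/-- Points whose coordinates have a common large prime factor. -/
theorem card_common_prime_le {M Y : ℕ} (hM : 0 < M) :
    (((square Y).filter (fun z : ℤ × ℤ => z ≠ 0 ∧ ∃ p : ℕ, p.Prime ∧ M < p ∧ (p : ℤ) ∣ z.1 ∧
      (p : ℤ) ∣ z.2)).card : ℝ) ≤ 16 * Y ^ 2 / M := by
  have hsub : (square Y).filter (fun z : ℤ × ℤ => z ≠ 0 ∧ ∃ p : ℕ, p.Prime ∧ M < p ∧ (p : ℤ) ∣ z.1 ∧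
      (p : ℤ) ∣ z.2) ⊆ (Finset.Ioc M Y).biUnion (fun p =>
        (symmInterval Y).filter (fun x => x ≡ 0 [ZMOD p]) ×ˢ
        (symmInterval Y).filter (fun x => x ≡ 0 [ZMOD p])) := by
    rintro ⟨a, b⟩ hz
    simp only [Finset.mem_filter, Finset.mem_product, ne_eq, Prod.mk_eq_zero, not_and] at hz
    obtain ⟨⟨ha, hb⟩, h0, p, hp, hMp, h1, h2⟩ := hz
    simp only [Finset.mem_biUnion, Finset.mem_product, Finset.mem_filter, ha, hb, true_and,
      Int.modEq_zero_iff_dvd]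
    refine ⟨p, Finset.mem_Ioc.2 ⟨hMp, ?_⟩, h1, h2⟩
    rw [Finset.mem_Icc] at ha hb
    -- Whichever coordinate is nonzero is a multiple of p, which forces p ≤ Y.
    by_cases ha0 : a = 0
    · have := Int.le_of_dvd (abs_pos.2 (h0 ha0)) ((dvd_abs _ _).2 h2)
      have := abs_le.2 hb
      omega
    · have := Int.le_of_dvd (abs_pos.2 ha0) ((dvd_abs _ _).2 h1)
      have := abs_le.2 ha
      omega
  have h1 : (((square Y).filter (fun z : ℤ × ℤ => z ≠ 0 ∧ ∃ p : ℕ, p.Prime ∧ M < p ∧ (p : ℤ) ∣ z.1 ∧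
      (p : ℤ) ∣ z.2)).card : ℝ) ≤ ∑ p ∈ Finset.Ioc M Y, 16 * (Y : ℝ) ^ 2 * ((p : ℝ) ^ 2)⁻¹ := by
    refine (Nat.cast_le.2 ((Finset.card_le_card hsub).trans Finset.card_biUnion_le)).trans ?_
    push_cast
    refine Finset.sum_le_sum fun p hp => ?_
    rw [Finset.mem_Ioc] at hp
    have hp0 : 0 < p := by omega
    have hpR : (0 : ℝ) < p := by exact_mod_cast hp0
    have hpY : (p : ℝ) ≤ Y := by exact_mod_cast hp.2
    have hY1 : (1 : ℝ) ≤ Y := by exact_mod_cast (by omega : 1 ≤ Y)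
    have h := card_symmInterval_modEq_le Y hp0 0
    -- Because p ≤ Y, the rounding error 1 is absorbed into the main term; squaring 4Y/p gives the
    -- constant 16.
    have h' : (2 * (Y : ℝ) + 1) / p + 1 ≤ 4 * Y / p := by
      rw [div_add_one hpR.ne']
      gcongr; linarith
    rw [Finset.card_product]; push_cast
    calc _ ≤ (4 * (Y : ℝ) / p) * (4 * (Y : ℝ) / p) := by gcongr <;> linarith
      _ = _ := by field_simp; norm_num
  refine h1.trans ?_
  rw [← Finset.mul_sum]
  rcases le_total M Y with h | h
  · have := sum_Ioc_inv_sq_le_sub (α := ℝ) hM.ne' h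
    rw [div_eq_mul_inv]
    gcongr
    have : (0 : ℝ) ≤ (Y : ℝ)⁻¹ := by positivity
    linarith
  · rw [Finset.Ioc_eq_empty_of_le h]; simp; positivity

-- For fixed a prime to p, 4a³ is a unit modulo p, so b lies in at most two classes modulo p². Each
-- class has at most (2Y + 1)/p² + 1 points. The first term sums over p > M to O(Y/M); the rounding
-- error 1 sums to π(LY), which is why p must be prime here.
open scoped Classical in
theorem card_medium_prime_le {M Y L : ℕ} (hM : 2 ≤ M) (hY : 0 < Y) :
    (((square Y).filter (fun z : ℤ × ℤ => ∃ p : ℕ, p.Prime ∧ M < p ∧ p ≤ L * Y ∧ ¬ (p : ℤ) ∣ z.1 ∧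
      (p : ℤ) ^ 2 ∣ 4 * z.1 ^ 3 - z.2 ^ 2)).card : ℝ) ≤
      3 * Y * (6 * Y / M + 2 * (Nat.primeCounting (L * Y))) := by
  have hYR : (1 : ℝ) ≤ Y := by exact_mod_cast hY
  set P : Finset ℕ := (Finset.Ioc M (L * Y)).filter Nat.Prime with hP
  have hsub : (square Y).filter (fun z : ℤ × ℤ => ∃ p : ℕ, p.Prime ∧ M < p ∧ p ≤ L * Y ∧ ¬ (p : ℤ) ∣ z.1 ∧
      (p : ℤ) ^ 2 ∣ 4 * z.1 ^ 3 - z.2 ^ 2) ⊆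
      (symmInterval Y).biUnion (fun a => (P.filter (fun p : ℕ => ¬ (p : ℤ) ∣ a)).biUnion (fun p : ℕ =>
        ((symmInterval Y).filter (fun b => (p : ℤ) ^ 2 ∣ 4 * a ^ 3 - b ^ 2)).image
          (fun b => (a, b)))) := by
    rintro ⟨a, b⟩ hz
    simp only [Finset.mem_filter, Finset.mem_product] at hz
    obtain ⟨⟨ha, hb⟩, p, hp, hMp, hpL, h1, h2⟩ := hz
    simp only [Finset.mem_biUnion, Finset.mem_image, Finset.mem_filter, hP, Finset.mem_Ioc]
    exact ⟨a, ha, p, ⟨⟨⟨hMp, hpL⟩, hp⟩, h1⟩, b, ⟨hb, h2⟩, rfl⟩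
  have hsum : ∑ p ∈ P, (2 * ((2 * (Y : ℝ) + 1) / (p : ℝ) ^ 2 + 1)) ≤
      6 * (Y : ℝ) / M + 2 * (Nat.primeCounting (L * Y) : ℝ) := by
    have h1 : ∑ p ∈ P, (2 * ((2 * (Y : ℝ) + 1) / (p : ℝ) ^ 2 + 1)) ≤
        ∑ p ∈ P, (6 * Y * ((p : ℝ) ^ 2)⁻¹ + 2) := by
      refine Finset.sum_le_sum fun p _ => ?_
      have : (2 * (Y : ℝ) + 1) / p ^ 2 ≤ 3 * Y * ((p : ℝ) ^ 2)⁻¹ := by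
        rw [div_eq_mul_inv]; gcongr; linarith
      linarith
    refine h1.trans ?_
    rw [Finset.sum_add_distrib, ← Finset.mul_sum, Finset.sum_const, nsmul_eq_mul, mul_comm _ (2 : ℝ)]
    refine add_le_add ?_ ?_
    · rw [div_eq_mul_inv]
      gcongr
      rcases le_total M (L * Y) with h | h
      · have h3 := sum_Ioc_inv_sq_le_sub (α := ℝ) (by omega : M ≠ 0) h
        have h4 : ∑ p ∈ P, ((p : ℝ) ^ 2)⁻¹ ≤ ∑ p ∈ Finset.Ioc M (L * Y), ((p : ℝ) ^ 2)⁻¹ :=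
          Finset.sum_le_sum_of_subset_of_nonneg (Finset.filter_subset _ _)
            fun _ _ _ => by positivity
        have : (0 : ℝ) ≤ ((L * Y : ℕ) : ℝ)⁻¹ := by positivity
        linarith
      · rw [hP, Finset.Ioc_eq_empty_of_le h]; simp
    · gcongr
      rw [← Nat.primesLE_card_eq_primeCounting]
      refine Finset.card_le_card fun p hp => ?_
      rw [hP, Finset.mem_filter, Finset.mem_Ioc] at hp
      rw [Nat.mem_primesLE]
      exact ⟨hp.1.2, hp.2⟩
  refine (Nat.cast_le.2 ((Finset.card_le_card hsub).trans Finset.card_biUnion_le)).trans ?_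
  push_cast
  calc _ ≤ ∑ a ∈ symmInterval Y, (6 * Y / M + 2 * (Nat.primeCounting (L * Y) : ℝ)) := by
        refine Finset.sum_le_sum fun a _ => ?_
        refine (Nat.cast_le.2 Finset.card_biUnion_le).trans ?_
        push_cast
        refine le_trans ?_ hsum
        refine (Finset.sum_le_sum (g := fun p : ℕ => (2 * ((2 * (Y : ℝ) + 1) / (p : ℝ) ^ 2 + 1)))
          fun p hp => ?_).trans
          (Finset.sum_le_sum_of_subset_of_nonneg (Finset.filter_subset _ _)
            fun _ _ _ => by positivity)
        simp only [hP, Finset.mem_filter, Finset.mem_Ioc] at hp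
        refine (Nat.cast_le.2 Finset.card_image_le).trans ?_
        have hp2 : 2 < p := by omega
        refine card_sq_modEq_le Y hp.1.2 hp2 ?_
        have hpp : Prime (p : ℤ) := Nat.prime_iff_prime_int.1 hp.1.2
        intro h
        rcases hpp.dvd_or_dvd h with h | h
        · rw [show (4 : ℤ) = 2 ^ 2 by norm_num] at h
          have := Int.le_of_dvd (by norm_num) (hpp.dvd_of_dvd_pow h); omega
        · exact hp.2 (hpp.dvd_of_dvd_pow h)
    _ ≤ _ := by
        rw [Finset.sum_const, card_symmInterval, nsmul_eq_mul]
        gcongr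
        push_cast; linarith

theorem card_le_of_forall_sub_le {S : Finset ℕ} {D : ℝ} (hD : 0 ≤ D)
    (h : ∀ p ∈ S, ∀ q ∈ S, p ≤ q → (q : ℝ) - p ≤ D) : (S.card : ℝ) ≤ 1 + D := by
  rcases S.eq_empty_or_nonempty with rfl | hS
  · simp; linarith
  · have hsub : S ⊆ Finset.Icc (S.min' hS) (S.min' hS + ⌊D⌋₊) := by
      intro q hq
      have hm := S.min'_le q hq
      have h1 := h _ (S.min'_mem hS) q hq hm
      rw [Finset.mem_Icc]
      refine ⟨hm, ?_⟩
      rw [← Nat.cast_sub hm] at h1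
      have := Nat.le_floor h1
      omega
    have h2 := Finset.card_le_card hsub
    rw [Nat.card_Icc] at h2
    have h3 : S.card ≤ 1 + ⌊D⌋₊ := by omega
    have h4 : (S.card : ℝ) ≤ 1 + ⌊D⌋₊ := by exact_mod_cast h3
    linarith [Nat.floor_le hD]

theorem sum_inv_sqrt_le (n : ℕ) : ∑ m ∈ Finset.Icc 1 n, (√(m : ℝ))⁻¹ ≤ 2 * √(n : ℝ) := by
  induction n with
  | zero => simp
  | succ n ih =>
    rw [Finset.sum_Icc_succ_top (by omega)]
    have hpos : 0 < √((n + 1 : ℕ) : ℝ) := Real.sqrt_pos.2 (by positivity)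
    have h1 : √((n + 1 : ℕ) : ℝ) ^ 2 = n + 1 := by rw [Real.sq_sqrt (by positivity)]; push_cast; ring
    have h2 : √(n : ℝ) ^ 2 = n := Real.sq_sqrt (by positivity)
    have h3 : (√((n + 1 : ℕ) : ℝ))⁻¹ ≤ 2 * √((n + 1 : ℕ) : ℝ) - 2 * √(n : ℝ) := by
      rw [inv_le_iff_one_le_mul₀ hpos]
      nlinarith [sq_nonneg (√((n + 1 : ℕ) : ℝ) - √(n : ℝ))]
    linarith

/-- For fixed `m`, the integers `p` for which `m p²` lies within `Y²` of a given number of size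
`Y³` lie in a short interval. -/
theorem card_mul_sq_near_le {Y m : ℕ} {δ K : ℝ} (hδ : 0 < δ) (hY : 0 < Y) (hm : 0 < m)
    (hYδ : 1 ≤ 2 * δ ^ 3 * Y) (hK : 4 * (δ * Y) ^ 3 ≤ K) (S : Finset ℕ)
    (hS : ∀ p ∈ S, |(m : ℝ) * p ^ 2 - K| ≤ Y ^ 2) :
    (S.card : ℝ) ≤ 1 + √(Y / (2 * δ ^ 3)) * (√(m : ℝ))⁻¹ := by
  have hYR : (0 : ℝ) < Y := by exact_mod_cast hY
  have hmR : (0 : ℝ) < m := by exact_mod_cast hm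
  refine card_le_of_forall_sub_le (by positivity) fun p hp q hq hpq => ?_
  have h1 := abs_le.1 (hS p hp)
  have h2 := abs_le.1 (hS q hq)
  have hpqR : (p : ℝ) ≤ q := by exact_mod_cast hpq
  have hp0 : (0 : ℝ) ≤ p := by positivity
  have hY2 : (Y : ℝ) ^ 2 ≤ 2 * δ ^ 3 * Y ^ 3 := by
    have := mul_le_mul_of_nonneg_right hYδ (by positivity : (0 : ℝ) ≤ (Y : ℝ) ^ 2)
    nlinarith
  -- K is at least 4δ³Y³, and the error Y² costs at most half of that.
  have hlow : 2 * δ ^ 3 * Y ^ 3 ≤ m * (p : ℝ) ^ 2 := by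
    have : 4 * (δ * Y) ^ 3 = 4 * δ ^ 3 * (Y : ℝ) ^ 3 := by ring
    nlinarith
  have hup : (m : ℝ) * (((q : ℝ) - p) * p) ≤ Y ^ 2 := by
    have : (m : ℝ) * (((q : ℝ) - p) * (2 * p)) ≤ m * (((q : ℝ) - p) * (q + p)) := by
      gcongr
      linarith
    nlinarith
  rw [← Real.sqrt_inv, ← Real.sqrt_mul (by positivity)]
  refine Real.le_sqrt_of_sq_le ?_
  have hpos : 0 < 2 * δ ^ 3 * (Y : ℝ) ^ 3 := by positivity
  have hsq : ((m : ℝ) * (((q : ℝ) - p) * p)) ^ 2 ≤ ((Y : ℝ) ^ 2) ^ 2 := by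
    have : 0 ≤ (m : ℝ) * (((q : ℝ) - p) * p) := by
      have : 0 ≤ (q : ℝ) - p := by linarith
      positivity
    gcongr
  -- Squaring `hup` produces the factor mp², which can then be replaced by its lower bound `hlow`;
  -- this removes p from the bound on q - p.
  have h5 : (m * ((q : ℝ) - p) ^ 2) * (2 * δ ^ 3 * Y ^ 3) ≤ Y ^ 4 := by
    calc (m * ((q : ℝ) - p) ^ 2) * (2 * δ ^ 3 * Y ^ 3)
        ≤ (m * ((q : ℝ) - p) ^ 2) * (m * (p : ℝ) ^ 2) := by gcongr
      _ = ((m : ℝ) * (((q : ℝ) - p) * p)) ^ 2 := by ring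
      _ ≤ _ := by rw [← pow_mul] at hsq; exact hsq
  rw [← div_eq_mul_inv, div_div, le_div_iff₀ (by positivity)]
  have h6 : ((q : ℝ) - p) ^ 2 * (2 * δ ^ 3 * m) * (Y : ℝ) ^ 3 ≤ Y * (Y : ℝ) ^ 3 := by
    calc _ = (m * ((q : ℝ) - p) ^ 2) * (2 * δ ^ 3 * Y ^ 3) := by ring
      _ ≤ _ := h5
      _ = _ := by ring
  exact le_of_mul_le_mul_right h6 (by positivity)

-- Write |4a³ - b²| = mp². Since p > LY, m is at most N = ⌊5Y/L²⌋. Since b² ≤ Y², mp² is within Y²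
-- of 4|a|³, so `card_mul_sq_near_le` allows few p for each m; then b is determined up to four
-- values. Summing over m gives O(N + √(YN)) = O(Y/L) for each a, with a constant depending on δ.
-- The lower bound on |a| keeps p away from 0 in that count.
open scoped Classical in
theorem card_large_prime_le {Y L : ℕ} {δ : ℝ} (hδ : 0 < δ) (hY : 0 < Y) (hL : 0 < L)
    (hYδ : 1 ≤ 2 * δ ^ 3 * Y) :
    (((square Y).filter (fun z : ℤ × ℤ => δ * Y ≤ |(z.1 : ℝ)| ∧ ∃ p : ℕ, L * Y < p ∧
      4 * z.1 ^ 3 - z.2 ^ 2 ≠ 0 ∧ (p : ℤ) ^ 2 ∣ 4 * z.1 ^ 3 - z.2 ^ 2)).card : ℝ) ≤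
      12 * (5 + 2 * √(5 / (2 * δ ^ 3))) * Y ^ 2 / L := by
  have hYR : (1 : ℝ) ≤ Y := by exact_mod_cast hY
  have hLR : (1 : ℝ) ≤ L := by exact_mod_cast hL
  set N : ℕ := ⌊5 * (Y : ℝ) / L ^ 2⌋₊ with hN
  -- The range only makes the set finite: p ≤ p² ≤ 5Y³.
  set S : ℤ → ℕ → Finset ℕ := fun a m => (Finset.range (5 * Y ^ 3 + 1)).filter
    (fun p : ℕ => |(m : ℝ) * (p : ℝ) ^ 2 - 4 * |(a : ℝ)| ^ 3| ≤ (Y : ℝ) ^ 2) with hS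
  -- m is the absolute value of the quotient, so both signs of 4a³ - b² have to be allowed.
  set T : ℤ → ℕ → ℕ → Finset ℤ := fun a m p =>
    (symmInterval Y).filter (fun b => b ^ 2 = 4 * a ^ 3 - m * p ^ 2) ∪
    (symmInterval Y).filter (fun b => b ^ 2 = 4 * a ^ 3 + m * p ^ 2) with hT
  have hTcard : ∀ a m p, (T a m p).card ≤ 4 := fun a m p =>
    (Finset.card_union_le _ _).trans (by
      have := card_filter_sq_eq_le (symmInterval Y) (4 * a ^ 3 - m * p ^ 2)
      have := card_filter_sq_eq_le (symmInterval Y) (4 * a ^ 3 + m * p ^ 2)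
      omega)
  have hsub : (square Y).filter (fun z : ℤ × ℤ => δ * Y ≤ |(z.1 : ℝ)| ∧ ∃ p : ℕ, L * Y < p ∧
      4 * z.1 ^ 3 - z.2 ^ 2 ≠ 0 ∧ (p : ℤ) ^ 2 ∣ 4 * z.1 ^ 3 - z.2 ^ 2) ⊆
      ((symmInterval Y).filter (fun a : ℤ => δ * Y ≤ |(a : ℝ)|)).biUnion (fun a =>
        (Finset.Icc 1 N).biUnion (fun m => (S a m).biUnion (fun p =>
          (T a m p).image (fun b => (a, b))))) := by
    rintro ⟨a, b⟩ hz
    simp only [Finset.mem_filter, Finset.mem_product] at hz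
    obtain ⟨⟨ha, hb⟩, hda, p, hp, hne, k, hk⟩ := hz
    have ha' := abs_le.2 (Finset.mem_Icc.1 ha)
    have hb' := abs_le.2 (Finset.mem_Icc.1 hb)
    have haR : |(a : ℝ)| ≤ Y := by exact_mod_cast ha'
    have hbR : (b : ℝ) ^ 2 ≤ Y ^ 2 := by
      have : |(b : ℝ)| ≤ Y := by exact_mod_cast hb'
      exact sq_le_sq' (abs_le.1 this).1 (abs_le.1 this).2
    have hpLY : (L : ℝ) * Y ≤ p := by exact_mod_cast hp.le
    have hpos : (0 : ℝ) < p := by exact_mod_cast (by omega : 0 < p)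
    have hkabs : ((k.natAbs : ℕ) : ℝ) * (p : ℝ) ^ 2 = |4 * (a : ℝ) ^ 3 - b ^ 2| := by
      have : (4 * (a : ℝ) ^ 3 - b ^ 2) = p ^ 2 * k := by exact_mod_cast hk
      rw [this, abs_mul, abs_of_nonneg (by positivity : (0 : ℝ) ≤ (p : ℝ) ^ 2), Nat.cast_natAbs,
        Int.cast_abs, mul_comm]
    have hcube : |4 * (a : ℝ) ^ 3| = 4 * |(a : ℝ)| ^ 3 := by
      rw [abs_mul, abs_pow]; norm_num
    have hup : |4 * (a : ℝ) ^ 3 - b ^ 2| ≤ 5 * (Y : ℝ) ^ 3 := by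
      have h1 := abs_sub (4 * (a : ℝ) ^ 3) ((b : ℝ) ^ 2)
      rw [hcube, abs_of_nonneg (sq_nonneg (b : ℝ))] at h1
      have h2 : |(a : ℝ)| ^ 3 ≤ Y ^ 3 := by gcongr
      have h3 : (Y : ℝ) ^ 2 ≤ Y ^ 3 := pow_le_pow_right₀ hYR (by norm_num)
      linarith
    have hk0 : k ≠ 0 := by rintro rfl; simp at hk; exact hne hk
    have hk1 : 1 ≤ k.natAbs := Int.natAbs_pos.2 hk0
    have hk1R : (1 : ℝ) ≤ (k.natAbs : ℕ) := by exact_mod_cast hk1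
    have hmem : a ∈ (symmInterval Y).filter (fun a : ℤ => δ * Y ≤ |(a : ℝ)|) :=
      Finset.mem_filter.2 ⟨ha, hda⟩
    refine Finset.mem_biUnion.2 ⟨a, hmem, Finset.mem_biUnion.2 ⟨k.natAbs, ?_,
      Finset.mem_biUnion.2 ⟨p, ?_, Finset.mem_image.2 ⟨b, ?_, rfl⟩⟩⟩⟩
    · rw [Finset.mem_Icc]
      refine ⟨hk1, Nat.le_floor ?_⟩
      rw [le_div_iff₀ (by positivity)]
      have h1 : ((k.natAbs : ℕ) : ℝ) * (L * Y) ^ 2 ≤ 5 * Y ^ 3 := by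
        refine le_trans ?_ (hkabs.le.trans hup)
        gcongr
      have h2 : (((k.natAbs : ℕ) : ℝ) * L ^ 2) * Y ^ 2 ≤ (5 * Y) * (Y : ℝ) ^ 2 := by
        calc _ = ((k.natAbs : ℕ) : ℝ) * (L * Y) ^ 2 := by ring
          _ ≤ _ := h1
          _ = _ := by ring
      exact le_of_mul_le_mul_right h2 (by positivity)
    · simp only [hS, Finset.mem_filter, Finset.mem_range]
      refine ⟨?_, ?_⟩
      · have h1 : (p : ℝ) ^ 2 ≤ 5 * Y ^ 3 := by
          refine le_trans ?_ (hkabs.le.trans hup)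
          exact le_mul_of_one_le_left (by positivity) hk1R
        have h2 : p ^ 2 ≤ 5 * Y ^ 3 := by exact_mod_cast h1
        have h3 : p ≤ p ^ 2 := Nat.le_self_pow two_ne_zero p
        omega
      · rw [hkabs, ← hcube]
        refine (abs_abs_sub_abs_le _ _).trans ?_
        rw [sub_sub_cancel_left, abs_neg, abs_of_nonneg (sq_nonneg (b : ℝ))]
        exact hbR
    · simp only [hT, Finset.mem_union, Finset.mem_filter, hb, true_and]
      rcases Int.natAbs_eq k with h | h
      · left; rw [← h]; linarith
      · right
        have h' : ((k.natAbs : ℕ) : ℤ) = -k := by omega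
        rw [h']; linarith
  refine (Nat.cast_le.2 ((Finset.card_le_card hsub).trans Finset.card_biUnion_le)).trans ?_
  push_cast
  have hNle : (N : ℝ) ≤ 5 * Y / L ^ 2 := Nat.floor_le (by positivity)
  have hA : √(Y / (2 * δ ^ 3)) * √(N : ℝ) ≤ √(5 / (2 * δ ^ 3)) * (Y / L) := by
    calc _ ≤ √(Y / (2 * δ ^ 3)) * √(5 * Y / L ^ 2) := by gcongr
      _ = √(5 / (2 * δ ^ 3) * (Y / L) ^ 2) := by
          rw [← Real.sqrt_mul (by positivity)]; congr 1; field_simp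
      _ = _ := by rw [Real.sqrt_mul (by positivity), Real.sqrt_sq (by positivity)]
  have hN2 : (N : ℝ) ≤ 5 * (Y / L) := by
    refine hNle.trans ?_
    rw [mul_div_assoc]
    gcongr
    exact le_self_pow₀ hLR two_ne_zero
  calc _ ≤ ∑ a ∈ (symmInterval Y).filter (fun a : ℤ => δ * Y ≤ |(a : ℝ)|),
        (4 * (5 + 2 * √(5 / (2 * δ ^ 3))) * (Y / L) : ℝ) := by
        refine Finset.sum_le_sum fun a ha => ?_
        refine (Nat.cast_le.2 Finset.card_biUnion_le).trans ?_
        push_cast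
        calc _ ≤ ∑ m ∈ Finset.Icc 1 N, (4 * (1 + √(Y / (2 * δ ^ 3)) * (√(m : ℝ))⁻¹) : ℝ) := by
              refine Finset.sum_le_sum fun m hm => ?_
              have h1 : ((S a m).biUnion (fun p =>
                (T a m p).image (fun b => (a, b)))).card ≤ (S a m).card * 4 :=
                Finset.card_biUnion_le_card_mul _ _ _
                  fun p _ => Finset.card_image_le.trans (hTcard a m p)
              have h2 : ((S a m).card : ℝ) ≤ 1 + √(Y / (2 * δ ^ 3)) * (√(m : ℝ))⁻¹ := by
                refine card_mul_sq_near_le (K := 4 * |(a : ℝ)| ^ 3) hδ hY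
                  (Finset.mem_Icc.1 hm).1 hYδ ?_ _ fun p hp => (Finset.mem_filter.1 hp).2
                have := (Finset.mem_filter.1 ha).2
                gcongr
              have h3 := Nat.cast_le (α := ℝ).2 h1
              push_cast at h3
              linarith
          _ = 4 * (N + √(Y / (2 * δ ^ 3)) * ∑ m ∈ Finset.Icc 1 N, (√(m : ℝ))⁻¹) := by
              rw [← Finset.mul_sum, Finset.sum_add_distrib, ← Finset.mul_sum]
              simp
          _ ≤ 4 * (5 * (Y / L) + 2 * (√(5 / (2 * δ ^ 3)) * (Y / L))) := by
              have := mul_le_mul_of_nonneg_left (sum_inv_sqrt_le N)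
                (Real.sqrt_nonneg (Y / (2 * δ ^ 3)))
              linarith
          _ = _ := by ring
    _ ≤ (3 * Y) * (4 * (5 + 2 * √(5 / (2 * δ ^ 3))) * (Y / L)) := by
        rw [Finset.sum_const, nsmul_eq_mul]
        gcongr
        have h1 := Finset.card_filter_le (symmInterval Y) (fun a : ℤ => δ * Y ≤ |(a : ℝ)|)
        rw [card_symmInterval] at h1
        have h2 : (_ : ℝ) ≤ ((2 * Y + 1 : ℕ) : ℝ) := Nat.cast_le.2 h1
        push_cast at h2
        linarith
    _ = _ := by ring

/-- Chebyshev's bound π(n) ≤ (log 4 + 1) n / log n for large n is enough. The saving over n is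
needed for primes of the order of Y, where a class modulo p² may contribute a whole point. -/
theorem eventually_primeCounting_le_mul {ε : ℝ} (hε : 0 < ε) :
    ∀ᶠ n : ℕ in atTop, (Nat.primeCounting n : ℝ) ≤ ε * n := by
  have h1 := tendsto_natCast_atTop_atTop (R := ℝ) |>.eventually
    (Chebyshev.eventually_primeCounting_le (ε := 1) one_pos)
  have h2 := (Real.tendsto_log_atTop.comp (tendsto_natCast_atTop_atTop (R := ℝ))).eventually
    (eventually_ge_atTop ((Real.log 4 + 1) / ε))
  filter_upwards [h1, h2, eventually_ge_atTop 2] with n h1 h2 hn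
  rw [Nat.floor_natCast] at h1
  refine h1.trans ?_
  simp only [Function.comp_apply] at h2
  have hlog : 0 < Real.log n := Real.log_pos (by exact_mod_cast hn)
  rw [div_le_iff₀ hlog]
  rw [div_le_iff₀ hε] at h2
  have : (0 : ℝ) ≤ n := by positivity
  nlinarith

theorem card_zero_disc_le (Y : ℕ) :
    ((square Y).filter (fun z : ℤ × ℤ => 4 * z.1 ^ 3 - z.2 ^ 2 = 0)).card ≤ 2 * (2 * Y + 1) := by
  classical
  have hsub : (square Y).filter (fun z : ℤ × ℤ => 4 * z.1 ^ 3 - z.2 ^ 2 = 0) ⊆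
      (symmInterval Y).biUnion (fun a =>
        ((symmInterval Y).filter (fun b => b ^ 2 = 4 * a ^ 3)).image (fun b => (a, b))) := by
    rintro ⟨a, b⟩ hz
    simp only [Finset.mem_filter, Finset.mem_product] at hz
    exact Finset.mem_biUnion.2 ⟨a, hz.1.1, Finset.mem_image.2
      ⟨b, Finset.mem_filter.2 ⟨hz.1.2, by linarith⟩, rfl⟩⟩
  refine (Finset.card_le_card hsub).trans ?_
  rw [mul_comm, ← card_symmInterval]
  exact Finset.card_biUnion_le_card_mul _ _ _ fun a _ =>
    Finset.card_image_le.trans (card_filter_sq_eq_le _ _)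

theorem card_small_fst_le {Y : ℕ} {δ : ℝ} (hδ : 0 ≤ δ) :
    (((square Y).filter (fun z : ℤ × ℤ => |(z.1 : ℝ)| ≤ δ * Y)).card : ℝ) ≤
      (2 * δ * Y + 1) * (2 * Y + 1) := by
  have hsub : (square Y).filter (fun z : ℤ × ℤ => |(z.1 : ℝ)| ≤ δ * Y) ⊆
      symmInterval ⌊δ * Y⌋₊ ×ˢ symmInterval Y := by
    rintro ⟨a, b⟩ hz
    simp only [Finset.mem_filter, Finset.mem_product] at hz
    refine Finset.mem_product.2 ⟨?_, hz.1.2⟩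
    have h1 : ((a.natAbs : ℕ) : ℝ) ≤ δ * Y := by rw [Nat.cast_natAbs, Int.cast_abs]; exact hz.2
    have := Nat.le_floor h1
    simp only [Finset.mem_Icc]
    omega
  have h := Nat.cast_le (α := ℝ).2 (Finset.card_le_card hsub)
  rw [Finset.card_product, card_symmInterval, card_symmInterval] at h
  push_cast at h
  refine h.trans ?_
  have := Nat.floor_le (by positivity : 0 ≤ δ * Y)
  exact mul_le_mul_of_nonneg_right (by linarith) (by positivity)

-- If p ∣ a and p² ∣ 4a³ - b², then p ∣ b, so a prime dividing a falls under the common-factor case.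
-- The remaining primes are split at LY, and above LY the points with |a| ≤ δY are set aside.
open scoped Classical in
theorem card_large_square_divisor_le (M Y L : ℕ) (δ : ℝ) :
    (((square Y).filter (fun z : ℤ × ℤ => ∃ p : ℕ, p.Prime ∧ M < p ∧
        (p : ℤ) ^ 2 ∣ 4 * z.1 ^ 3 - z.2 ^ 2)).card : ℝ) ≤
      ((square Y).filter (fun z : ℤ × ℤ => 4 * z.1 ^ 3 - z.2 ^ 2 = 0)).card +
      (((square Y).filter (fun z : ℤ × ℤ => z ≠ 0 ∧ ∃ p : ℕ, p.Prime ∧ M < p ∧ (p : ℤ) ∣ z.1 ∧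
        (p : ℤ) ∣ z.2)).card +
      (((square Y).filter (fun z : ℤ × ℤ => ∃ p : ℕ, p.Prime ∧ M < p ∧ p ≤ L * Y ∧
        ¬ (p : ℤ) ∣ z.1 ∧ (p : ℤ) ^ 2 ∣ 4 * z.1 ^ 3 - z.2 ^ 2)).card +
      (((square Y).filter (fun z : ℤ × ℤ => δ * Y ≤ |(z.1 : ℝ)| ∧ ∃ p : ℕ, L * Y < p ∧
        4 * z.1 ^ 3 - z.2 ^ 2 ≠ 0 ∧ (p : ℤ) ^ 2 ∣ 4 * z.1 ^ 3 - z.2 ^ 2)).card +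
      ((square Y).filter (fun z : ℤ × ℤ => |(z.1 : ℝ)| ≤ δ * Y)).card))) := by
  have hsub : (square Y).filter (fun z : ℤ × ℤ => ∃ p : ℕ, p.Prime ∧ M < p ∧
        (p : ℤ) ^ 2 ∣ 4 * z.1 ^ 3 - z.2 ^ 2) ⊆
      (square Y).filter (fun z : ℤ × ℤ => 4 * z.1 ^ 3 - z.2 ^ 2 = 0) ∪
      ((square Y).filter (fun z : ℤ × ℤ => z ≠ 0 ∧ ∃ p : ℕ, p.Prime ∧ M < p ∧ (p : ℤ) ∣ z.1 ∧
        (p : ℤ) ∣ z.2) ∪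
      ((square Y).filter (fun z : ℤ × ℤ => ∃ p : ℕ, p.Prime ∧ M < p ∧ p ≤ L * Y ∧
        ¬ (p : ℤ) ∣ z.1 ∧ (p : ℤ) ^ 2 ∣ 4 * z.1 ^ 3 - z.2 ^ 2) ∪
      ((square Y).filter (fun z : ℤ × ℤ => δ * Y ≤ |(z.1 : ℝ)| ∧ ∃ p : ℕ, L * Y < p ∧
        4 * z.1 ^ 3 - z.2 ^ 2 ≠ 0 ∧ (p : ℤ) ^ 2 ∣ 4 * z.1 ^ 3 - z.2 ^ 2) ∪
      (square Y).filter (fun z : ℤ × ℤ => |(z.1 : ℝ)| ≤ δ * Y)))) := by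
    intro z hz
    simp only [Finset.mem_filter] at hz
    obtain ⟨hz, p, hp, hMp, hdvd⟩ := hz
    simp only [Finset.mem_union, Finset.mem_filter, hz, true_and]
    by_cases h0 : 4 * z.1 ^ 3 - z.2 ^ 2 = 0
    · exact Or.inl h0
    refine Or.inr ?_
    have hpp : Prime (p : ℤ) := Nat.prime_iff_prime_int.1 hp
    by_cases h1 : (p : ℤ) ∣ z.1
    · refine Or.inl ⟨?_, p, hp, hMp, h1, ?_⟩
      · rintro rfl; simp at h0
      · refine hpp.dvd_of_dvd_pow (n := 2) ?_
        have h2 : (p : ℤ) ∣ 4 * z.1 ^ 3 := (h1.trans (dvd_pow_self _ three_ne_zero)).mul_left 4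
        have := dvd_sub h2 ((dvd_pow_self (p : ℤ) two_ne_zero).trans hdvd)
        simpa using this
    refine Or.inr ?_
    by_cases h2 : p ≤ L * Y
    · exact Or.inl ⟨p, hp, hMp, h2, h1, hdvd⟩
    refine Or.inr ?_
    rcases le_total (δ * Y) |(z.1 : ℝ)| with h3 | h3
    · exact Or.inl ⟨h3, p, not_le.1 h2, h0, hdvd⟩
    · exact Or.inr h3
  have hcard := (Finset.card_le_card hsub).trans ((Finset.card_union_le _ _).trans
    (add_le_add le_rfl ((Finset.card_union_le _ _).trans (add_le_add le_rfl
      ((Finset.card_union_le _ _).trans (add_le_add le_rfl (Finset.card_union_le _ _)))))))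
  have hcardR := Nat.cast_le (α := ℝ).2 hcard
  push_cast at hcardR
  exact hcardR

open scoped Classical in
/-- The tail estimate for the squarefree sieve of `4a³ - b²` in a square. -/
theorem exists_card_large_square_divisor_le {ε : ℝ} (hε : 0 < ε) :
    ∃ M₀ : ℕ, ∀ M ≥ M₀, ∀ᶠ Y : ℕ in atTop,
      (((square Y).filter (fun z : ℤ × ℤ => ∃ p : ℕ, p.Prime ∧ M < p ∧
        (p : ℤ) ^ 2 ∣ 4 * z.1 ^ 3 - z.2 ^ 2)).card : ℝ) ≤ ε * Y ^ 2 := by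
  -- Each of the five sets is allowed εY²/5. The parameter δ makes the strip |a| ≤ δY small, L is
  -- chosen after δ to beat the constant C, M ≥ 180/ε handles the sums of 1/p², and Y is taken large
  -- last.
  set δ : ℝ := ε / 60 with hδdef
  have hδ : 0 < δ := by positivity
  set C : ℝ := 12 * (5 + 2 * √(5 / (2 * δ ^ 3))) with hC
  obtain ⟨L, hL⟩ := exists_nat_ge (5 * C / ε + 1)
  have hC0 : 0 ≤ C := by positivity
  have hLR : (1 : ℝ) ≤ L := le_trans (by have : 0 ≤ 5 * C / ε := by positivity
                                         linarith) hL
  have hL0 : 0 < L := by exact_mod_cast (by linarith : (0 : ℝ) < L)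
  have hCL : C / L ≤ ε / 5 := by
    rw [div_le_iff₀ (by linarith)]
    have : 5 * C / ε ≤ L := by linarith
    rw [div_le_iff₀ hε] at this
    linarith
  obtain ⟨M₁, hM₁⟩ := exists_nat_ge (180 / ε)
  refine ⟨max 2 M₁, fun M hM => ?_⟩
  have hM2 : 2 ≤ M := (le_max_left _ _).trans hM
  have hMR : 180 / ε ≤ M := hM₁.trans (by exact_mod_cast (le_max_right _ _).trans hM)
  have hM0 : (0 : ℝ) < M := by exact_mod_cast (by omega : 0 < M)
  have hMε : 180 ≤ ε * M := by rw [div_le_iff₀ hε] at hMR; linarith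
  have hpi := (tendsto_id.const_mul_atTop' hL0).eventually
    (eventually_primeCounting_le_mul (ε := ε / (60 * L)) (by positivity))
  have hbig := (tendsto_natCast_atTop_atTop (R := ℝ)).eventually
    (eventually_ge_atTop (max (30 / ε) (1 / (2 * δ ^ 3))))
  filter_upwards [hpi, hbig, eventually_ge_atTop 1] with Y hpi hbig hY
  have hYR : (1 : ℝ) ≤ Y := by exact_mod_cast hY
  have hY30 : 30 ≤ ε * Y := by
    have := (le_max_left _ _).trans hbig
    rw [div_le_iff₀ hε] at this; linarith
  have hYδ : 1 ≤ 2 * δ ^ 3 * Y := by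
    have := (le_max_right _ _).trans hbig
    rw [div_le_iff₀ (by positivity)] at this; linarith
  refine (card_large_square_divisor_le M Y L δ).trans ?_
  have e0 : (((square Y).filter (fun z : ℤ × ℤ => 4 * z.1 ^ 3 - z.2 ^ 2 = 0)).card : ℝ) ≤
      ε / 5 * Y ^ 2 := by
    have := Nat.cast_le (α := ℝ).2 (card_zero_disc_le Y)
    push_cast at this
    have h : 30 * (Y : ℝ) ≤ ε * Y * Y := mul_le_mul_of_nonneg_right hY30 (by positivity)
    linarith
  have e1 := card_common_prime_le (Y := Y) (by omega : 0 < M)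
  have e1' : 16 * (Y : ℝ) ^ 2 / M ≤ ε / 5 * Y ^ 2 := by
    rw [div_le_iff₀ hM0]
    have h : 180 * (Y : ℝ) ^ 2 ≤ ε * M * Y ^ 2 :=
      mul_le_mul_of_nonneg_right hMε (by positivity)
    linarith [sq_nonneg (Y : ℝ)]
  have e2 := card_medium_prime_le (L := L) hM2 hY
  have e2' : 3 * (Y : ℝ) * (6 * Y / M + 2 * (Nat.primeCounting (L * Y))) ≤ ε / 5 * Y ^ 2 := by
    have h1 : 6 * (Y : ℝ) / M ≤ ε / 30 * Y := by
      rw [div_le_iff₀ hM0]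
      have h : 180 * (Y : ℝ) ≤ ε * M * Y := mul_le_mul_of_nonneg_right hMε (by positivity)
      linarith
    have h2 : (Nat.primeCounting (L * Y) : ℝ) ≤ ε / 60 * Y := by
      simp only [id] at hpi
      refine hpi.trans (le_of_eq ?_)
      push_cast; field_simp
    calc _ ≤ 3 * (Y : ℝ) * (ε / 30 * Y + 2 * (ε / 60 * Y)) := by gcongr
      _ = _ := by ring
  have e3 := card_large_prime_le (L := L) hδ hY hL0 hYδ
  have e3' : 12 * (5 + 2 * √(5 / (2 * δ ^ 3))) * (Y : ℝ) ^ 2 / L ≤ ε / 5 * Y ^ 2 := by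
    rw [← hC, mul_div_right_comm]; gcongr
  have e4 := card_small_fst_le (Y := Y) hδ.le
  have e4' : (2 * δ * (Y : ℝ) + 1) * (2 * Y + 1) ≤ ε / 5 * Y ^ 2 := by
    calc _ ≤ (2 * δ * (Y : ℝ) + 1) * (3 * Y) := by gcongr; linarith
      _ = ε / 10 * Y ^ 2 + 3 * Y := by rw [hδdef]; ring
      _ ≤ _ := by
        have h : 30 * (Y : ℝ) ≤ ε * Y * Y := mul_le_mul_of_nonneg_right hY30 (by positivity)
        linarith
  linarith

/-! ### Residue discs in ℤ_p², Haar measure and p-adic equidistribution. -/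

section Padic

variable (p : ℕ) [Fact p.Prime]

/-- Reduction of a pair of `p`-adic integers modulo `p ^ k`. -/
noncomputable def reduction (k : ℕ) (x : ℤ_[p] × ℤ_[p]) : ZMod (p ^ k) × ZMod (p ^ k) :=
  (PadicInt.toZModPow k x.1, PadicInt.toZModPow k x.2)

/-- A pair of integers as a pair of `p`-adic integers. -/
noncomputable def intPair (z : ℤ × ℤ) : ℤ_[p] × ℤ_[p] := ((z.1 : ℤ_[p]), (z.2 : ℤ_[p]))

instance : IsProbabilityMeasure
    (Measure.addHaarMeasure (⊤ : TopologicalSpace.PositiveCompacts ℤ_[p])) :=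
  ⟨Measure.addHaarMeasure_self⟩

instance : IsProbabilityMeasure (padicPlaneMeasure p) := by
  unfold padicPlaneMeasure; infer_instance

theorem toZModPow_eq_iff (k : ℕ) (x y : ℤ_[p]) :
    PadicInt.toZModPow k x = PadicInt.toZModPow k y ↔ ‖x - y‖ ≤ (p : ℝ) ^ (-k : ℤ) := by
  rw [PadicInt.norm_le_pow_iff_mem_span_pow, ← PadicInt.ker_toZModPow, RingHom.mem_ker, map_sub,
    sub_eq_zero]

theorem reduction_eq_iff (k : ℕ) (x y : ℤ_[p] × ℤ_[p]) :
    reduction p k x = reduction p k y ↔ dist x y ≤ (p : ℝ) ^ (-k : ℤ) := by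
  rw [Prod.dist_eq, max_le_iff, dist_eq_norm, dist_eq_norm, ← toZModPow_eq_iff, ← toZModPow_eq_iff]
  exact Prod.ext_iff

theorem isClosed_toZModPow_fiber (k : ℕ) (r : ZMod (p ^ k)) :
    IsClosed {x : ℤ_[p] | PadicInt.toZModPow k x = r} := by
  obtain ⟨y, rfl⟩ := ZMod.ringHom_surjective (PadicInt.toZModPow (p := p) k) r
  simp_rw [toZModPow_eq_iff, ← dist_eq_norm]
  exact Metric.isClosed_closedBall

/-- The fibre over 0 is a closed subgroup of index p^k in a group of total mass 1, and the other
fibres are its translates. -/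
theorem measure_toZModPow_fiber (k : ℕ) (r : ZMod (p ^ k)) :
    Measure.addHaarMeasure (⊤ : TopologicalSpace.PositiveCompacts ℤ_[p])
      {x : ℤ_[p] | PadicInt.toZModPow k x = r} = ((p : ENNReal) ^ k)⁻¹ := by
  set μ := Measure.addHaarMeasure (⊤ : TopologicalSpace.PositiveCompacts ℤ_[p])
  set H : AddSubgroup ℤ_[p] := (PadicInt.toZModPow (p := p) k).toAddMonoidHom.ker with hH
  have hHset : (H : Set ℤ_[p]) = {x : ℤ_[p] | PadicInt.toZModPow k x = 0} := by
    ext x; simp [hH, AddMonoidHom.mem_ker]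
  have hsurj := ZMod.ringHom_surjective (PadicInt.toZModPow (p := p) k)
  have hindex : H.index = p ^ k := by
    rw [hH, AddSubgroup.index_ker, AddMonoidHom.range_eq_top.2 hsurj]
    simp
  have hpk : p ^ k ≠ 0 := pow_ne_zero _ (Fact.out : p.Prime).ne_zero
  have : H.FiniteIndex := ⟨by rw [hindex]; exact hpk⟩
  have hmul := AddSubgroup.index_mul_measure H
    (by rw [hHset]; exact (isClosed_toZModPow_fiber p k 0).measurableSet) μ
  rw [hindex, measure_univ] at hmul
  have hμH : μ H = ((p : ENNReal) ^ k)⁻¹ := by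
    rw [ENNReal.eq_inv_of_mul_eq_one_left (a := μ H) (b := ((p ^ k : ℕ) : ENNReal))
      (by rw [mul_comm]; exact hmul)]
    push_cast; rfl
  obtain ⟨y, rfl⟩ := hsurj r
  rw [← hμH, ← measure_preimage_add μ (-y) (H : Set ℤ_[p]), hHset]
  congr 1
  ext x
  simp only [Set.mem_ofPred_eq, Set.mem_preimage, map_add, map_neg]
  rw [neg_add_eq_zero, eq_comm]

theorem measurableSet_reduction_fiber (k : ℕ) (t : ZMod (p ^ k) × ZMod (p ^ k)) :
    MeasurableSet {x | reduction p k x = t} := by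
  have : {x | reduction p k x = t} = {x : ℤ_[p] | PadicInt.toZModPow k x = t.1} ×ˢ
      {x : ℤ_[p] | PadicInt.toZModPow k x = t.2} := by
    ext x; simp [reduction, Prod.ext_iff]
  rw [this]
  exact (isClosed_toZModPow_fiber p k _).measurableSet.prod
    (isClosed_toZModPow_fiber p k _).measurableSet

theorem measureReal_reduction_fiber (k : ℕ) (t : ZMod (p ^ k) × ZMod (p ^ k)) :
    (padicPlaneMeasure p).real {x | reduction p k x = t} = (((p : ℝ) ^ k) ^ 2)⁻¹ := by
  have : {x | reduction p k x = t} = {x : ℤ_[p] | PadicInt.toZModPow k x = t.1} ×ˢ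
      {x : ℤ_[p] | PadicInt.toZModPow k x = t.2} := by
    ext x; simp [reduction, Prod.ext_iff]
  rw [this, padicPlaneMeasure, measureReal_prod_prod, Measure.real, Measure.real,
    measure_toZModPow_fiber, measure_toZModPow_fiber]
  simp [sq]

theorem reduction_intPair_eq_iff (k : ℕ) (z : ℤ × ℤ) (a b : ℤ) :
    reduction p k (intPair p z) = ((a : ZMod (p ^ k)), (b : ZMod (p ^ k))) ↔
      z.1 ≡ a [ZMOD (p ^ k : ℕ)] ∧ z.2 ≡ b [ZMOD (p ^ k : ℕ)] := by
  simp only [reduction, intPair, map_intCast, Prod.mk.injEq, ZMod.intCast_eq_intCast_iff]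

/-- The union of the residue discs modulo `p ^ k` that are contained in `U`. -/
def innerDiscs (k : ℕ) (U : Set (ℤ_[p] × ℤ_[p])) : Set (ℤ_[p] × ℤ_[p]) :=
  {x | ∀ y, reduction p k y = reduction p k x → y ∈ U}

variable {p}

theorem innerDiscs_subset (k : ℕ) (U : Set (ℤ_[p] × ℤ_[p])) : innerDiscs p k U ⊆ U :=
  fun x hx => hx x rfl

theorem innerDiscs_mono (U : Set (ℤ_[p] × ℤ_[p])) : Monotone fun k => innerDiscs p k U := by
  intro k l hkl x hx y hy
  refine hx y ?_
  rw [reduction_eq_iff] at hy ⊢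
  refine hy.trans (zpow_le_zpow_right₀ ?_ (by omega))
  exact_mod_cast (Fact.out : p.Prime).one_le

theorem iUnion_innerDiscs {U : Set (ℤ_[p] × ℤ_[p])} (hU : IsOpen U) :
    ⋃ k, innerDiscs p k U = U := by
  refine Set.Subset.antisymm (Set.iUnion_subset fun k => innerDiscs_subset k U) fun x hx => ?_
  obtain ⟨ε, hε, hball⟩ := Metric.isOpen_iff.1 hU x hx
  obtain ⟨k, hk⟩ := PadicInt.exists_pow_neg_lt p hε
  refine Set.mem_iUnion.2 ⟨k, fun y hy => hball ?_⟩
  exact Metric.mem_ball.2 (((reduction_eq_iff p k y x).1 hy).trans_lt hk)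

theorem innerDiscs_eq_preimage (k : ℕ) (U : Set (ℤ_[p] × ℤ_[p])) :
    ∃ T : Finset (ZMod (p ^ k) × ZMod (p ^ k)), innerDiscs p k U = {x | reduction p k x ∈ T} := by
  classical
  have : NeZero (p ^ k) := ⟨pow_ne_zero _ (Fact.out : p.Prime).ne_zero⟩
  refine ⟨Finset.univ.filter (fun t => ∀ y, reduction p k y = t → y ∈ U), ?_⟩
  ext x
  simp [innerDiscs]

open scoped Classical in
/-- The number of points of `R` in `S`, divided by `X²`. -/
noncomputable def pointDensity (R : ℝ → Finset (ℤ × ℤ)) (S : Set (ℤ × ℤ)) (X : ℝ) : ℝ :=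
  ((R X).filter (· ∈ S)).card / X ^ 2

theorem pointDensity_nonneg (R : ℝ → Finset (ℤ × ℤ)) (S : Set (ℤ × ℤ)) (X : ℝ) :
    0 ≤ pointDensity R S X := by unfold pointDensity; positivity

theorem pointDensity_mono (R : ℝ → Finset (ℤ × ℤ)) {S T : Set (ℤ × ℤ)} (h : S ⊆ T) (X : ℝ) :
    pointDensity R S X ≤ pointDensity R T X := by
  classical
  unfold pointDensity
  gcongr

theorem pointDensity_add_compl (R : ℝ → Finset (ℤ × ℤ)) (S : Set (ℤ × ℤ)) (X : ℝ) :
    pointDensity R S X + pointDensity R Sᶜ X = pointDensity R Set.univ X := by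
  classical
  unfold pointDensity
  rw [← add_div]
  congr 1
  have := Finset.card_filter_add_card_filter_not (s := R X) (· ∈ S)
  simp only [Set.mem_univ, Finset.filter_true, Set.mem_compl_iff]
  exact_mod_cast this

variable {R : ℝ → Finset (ℤ × ℤ)} {c : ℝ}

theorem tendsto_pointDensity_reduction
    (h : ∀ (k : ℕ) (a b : ℤ), Tendsto (pointDensity R
      {z | z.1 ≡ a [ZMOD (p ^ k : ℕ)] ∧ z.2 ≡ b [ZMOD (p ^ k : ℕ)]}) atTop
      (𝓝 (c / ((p ^ k : ℕ) : ℝ) ^ 2)))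
    (k : ℕ) (T : Finset (ZMod (p ^ k) × ZMod (p ^ k))) :
    Tendsto (pointDensity R {z | reduction p k (intPair p z) ∈ T}) atTop
      (𝓝 (c * (padicPlaneMeasure p).real {x | reduction p k x ∈ T})) := by
  classical
  have h1 : ∀ X, pointDensity R {z | reduction p k (intPair p z) ∈ T} X =
      ∑ t ∈ T, pointDensity R {z | reduction p k (intPair p z) = t} X := by
    intro X
    unfold pointDensity
    rw [← Finset.sum_div]
    congr 1
    rw [Finset.card_eq_sum_card_fiberwise (t := T) (f := fun z => reduction p k (intPair p z))
      (by intro z hz; simp only [Finset.coe_filter] at hz; exact hz.2)]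
    push_cast
    refine Finset.sum_congr rfl fun t ht => ?_
    rw [Finset.filter_filter]
    congr 2
    ext z
    simp only [Set.mem_ofPred_eq, Finset.mem_filter]
    refine and_congr_right fun _ => ⟨fun hz => hz.2, fun hz => ⟨hz ▸ ht, hz⟩⟩
  have h2 : (padicPlaneMeasure p).real {x | reduction p k x ∈ T} =
      ∑ t ∈ T, (padicPlaneMeasure p).real {x | reduction p k x = t} := by
    rw [← measureReal_biUnion_finset]
    · congr 1; ext x; simp
    · intro s _ t _ hst
      exact Set.disjoint_left.2 fun x hx hx' => hst (hx.symm.trans hx')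
    · exact fun t _ => measurableSet_reduction_fiber p k t
  rw [h2, Finset.mul_sum]
  refine Tendsto.congr (fun X => (h1 X).symm) (tendsto_finsetSum _ fun t _ => ?_)
  obtain ⟨a, ha⟩ := ZMod.intCast_surjective t.1
  obtain ⟨b, hb⟩ := ZMod.intCast_surjective t.2
  have ht : t = ((a : ZMod (p ^ k)), (b : ZMod (p ^ k))) := by rw [ha, hb]
  rw [measureReal_reduction_fiber, ← div_eq_mul_inv, ht]
  simp_rw [reduction_intPair_eq_iff]
  exact_mod_cast h k a b

/-- The discs inside U exhaust U, so finitely many of them carry almost all of its measure. Only a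
lower bound is available: an open set of small measure can contain every integer point. -/
theorem eventually_le_pointDensity_of_isOpen
    (h : ∀ (k : ℕ) (a b : ℤ), Tendsto (pointDensity R
      {z | z.1 ≡ a [ZMOD (p ^ k : ℕ)] ∧ z.2 ≡ b [ZMOD (p ^ k : ℕ)]}) atTop
      (𝓝 (c / ((p ^ k : ℕ) : ℝ) ^ 2)))
    {U : Set (ℤ_[p] × ℤ_[p])} (hU : IsOpen U) {ε : ℝ} (hε : 0 < ε) :
    ∀ᶠ X in atTop, c * (padicPlaneMeasure p).real U - ε ≤
      pointDensity R {z | intPair p z ∈ U} X := by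
  have h1 : Tendsto (fun k => c * (padicPlaneMeasure p).real (innerDiscs p k U)) atTop
      (𝓝 (c * (padicPlaneMeasure p).real U)) := by
    refine Tendsto.const_mul _ ?_
    have := tendsto_measure_iUnion_atTop (μ := padicPlaneMeasure p) (innerDiscs_mono U)
    rw [iUnion_innerDiscs hU] at this
    exact (ENNReal.tendsto_toReal (measure_ne_top _ _)).comp this
  obtain ⟨k, hk⟩ := (h1.eventually (lt_mem_nhds (sub_lt_self _ (half_pos hε)))).exists
  obtain ⟨T, hT⟩ := innerDiscs_eq_preimage k U
  have h2 := tendsto_pointDensity_reduction h k T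
  rw [← hT] at h2
  filter_upwards [h2.eventually (lt_mem_nhds (sub_lt_self _ (half_pos hε)))] with X hX
  have h3 : pointDensity R {z | reduction p k (intPair p z) ∈ T} X ≤
      pointDensity R {z | intPair p z ∈ U} X := by
    refine pointDensity_mono R (fun z hz => innerDiscs_subset k U ?_) X
    rw [hT]; exact hz
  linarith

/-- Equidistribution in residue classes modulo powers of `p` implies equidistribution with respect
to sets whose boundary has measure zero. -/
theorem tendsto_pointDensity_of_frontier_null
    (h : ∀ (k : ℕ) (a b : ℤ), Tendsto (pointDensity R
      {z | z.1 ≡ a [ZMOD (p ^ k : ℕ)] ∧ z.2 ≡ b [ZMOD (p ^ k : ℕ)]}) atTop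
      (𝓝 (c / ((p ^ k : ℕ) : ℝ) ^ 2)))
    {W : Set (ℤ_[p] × ℤ_[p])} (hW : padicPlaneMeasure p (frontier W) = 0) :
    Tendsto (pointDensity R {z | intPair p z ∈ W}) atTop
      (𝓝 (c * (padicPlaneMeasure p).real W)) := by
  have lower : ∀ V : Set (ℤ_[p] × ℤ_[p]), padicPlaneMeasure p (frontier V) = 0 → ∀ ε > 0,
      ∀ᶠ X in atTop, c * (padicPlaneMeasure p).real V - ε ≤
        pointDensity R {z | intPair p z ∈ V} X := by
    intro V hV ε hε
    filter_upwards [eventually_le_pointDensity_of_isOpen h (isOpen_interior (s := V)) hε]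
      with X hX
    have e : (padicPlaneMeasure p).real (interior V) = (padicPlaneMeasure p).real V :=
      congrArg ENNReal.toReal (measure_congr (interior_ae_eq_of_null_frontier hV))
    rw [e] at hX
    have hs : {z : ℤ × ℤ | intPair p z ∈ interior V} ⊆ {z | intPair p z ∈ V} :=
      Set.preimage_mono (f := intPair p) interior_subset
    exact hX.trans (pointDensity_mono R hs X)
  have htot : Tendsto (pointDensity R Set.univ) atTop (𝓝 c) := by
    have h0 := h 0 0 0
    have e1 : {z : ℤ × ℤ | z.1 ≡ 0 [ZMOD (p ^ 0 : ℕ)] ∧ z.2 ≡ 0 [ZMOD (p ^ 0 : ℕ)]} = Set.univ := by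
      refine Set.eq_univ_of_forall fun z => ?_
      rw [pow_zero, Nat.cast_one]
      exact ⟨Int.modEq_one, Int.modEq_one⟩
    have e2 : c / ((p ^ 0 : ℕ) : ℝ) ^ 2 = c := by rw [pow_zero]; norm_num
    rwa [e1, e2] at h0
  have hcompl : (padicPlaneMeasure p).real Wᶜ = 1 - (padicPlaneMeasure p).real W := by
    exact probReal_compl_eq_one_sub₀ (nullMeasurableSet_of_null_frontier hW)
  rw [Metric.tendsto_atTop']
  intro ε hε
  -- The upper bound for W is the lower bound for its complement, which has the same boundary,
  -- subtracted from the total density.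
  have h1 := lower W hW (ε / 2) (half_pos hε)
  have h2 := lower Wᶜ (by rwa [frontier_compl]) (ε / 4) (by positivity)
  have h3 := htot.eventually (gt_mem_nhds (lt_add_of_pos_right c (by positivity : 0 < ε / 4)))
  obtain ⟨X₀, hX₀⟩ := eventually_atTop.1 (h1.and (h2.and h3))
  refine ⟨X₀, fun X hX => ?_⟩
  obtain ⟨h1, h2, h3⟩ := hX₀ X hX.le
  rw [hcompl] at h2
  have h4 := pointDensity_add_compl R {z | intPair p z ∈ W} X
  have h5 : {z | intPair p z ∈ W}ᶜ = {z | intPair p z ∈ Wᶜ} := rfl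
  rw [h5] at h4
  rw [Real.dist_eq, abs_lt]
  constructor <;> linarith

end Padic

/-! ### Independence of primes and the sieve. -/

/-- The pairs of integers in a residue class modulo `N`. -/
def residueClass (N : ℕ) (a b : ℤ) : Set (ℤ × ℤ) := {z | z.1 ≡ a [ZMOD N] ∧ z.2 ≡ b [ZMOD N]}

/-- The sets of points `R X` are equidistributed in residue classes, with density `c`. -/
def IsEquidistributed (R : ℝ → Finset (ℤ × ℤ)) (c : ℝ) : Prop :=
  ∀ N : ℕ, 0 < N → ∀ a b : ℤ,
    Tendsto (pointDensity R (residueClass N a b)) atTop (𝓝 (c / (N : ℝ) ^ 2))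

open scoped Classical in
/-- The points of `R X` that lie in `S`. -/
noncomputable def restrictTo (R : ℝ → Finset (ℤ × ℤ)) (S : Set (ℤ × ℤ)) (X : ℝ) :
    Finset (ℤ × ℤ) := (R X).filter (· ∈ S)

theorem pointDensity_restrictTo (R : ℝ → Finset (ℤ × ℤ)) (S T : Set (ℤ × ℤ)) :
    pointDensity (restrictTo R S) T = pointDensity R (S ∩ T) := by
  ext X
  unfold pointDensity restrictTo
  rw [Finset.filter_filter]
  congr!

theorem pointDensity_union_le (R : ℝ → Finset (ℤ × ℤ)) {S T E : Set (ℤ × ℤ)} (h : S ⊆ T ∪ E)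
    (X : ℝ) : pointDensity R S X ≤ pointDensity R T X + pointDensity R E X := by
  classical
  refine (pointDensity_mono R h X).trans ?_
  unfold pointDensity
  rw [← add_div]
  refine div_le_div_of_nonneg_right ?_ (sq_nonneg X)
  have h1 : (R X).filter (· ∈ T ∪ E) ⊆ (R X).filter (· ∈ T) ∪ (R X).filter (· ∈ E) := by
    intro z hz
    simp only [Finset.mem_filter, Finset.mem_union, Set.mem_union] at hz ⊢
    tauto
  have h2 := (Finset.card_le_card h1).trans (Finset.card_union_le _ _)
  refine (Nat.cast_le.2 ?_).trans_eq (Nat.cast_add _ _)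
  refine (le_of_eq ?_).trans h2
  congr!

theorem exists_residueClass_inter {N M : ℕ} (h : N.Coprime M) (a b a' b' : ℤ) :
    ∃ a'' b'', residueClass N a b ∩ residueClass M a' b' = residueClass (N * M) a'' b'' := by
  have crt : ∀ x y : ℤ, ∃ u : ℤ, ∀ z : ℤ,
      (z ≡ x [ZMOD N] ∧ z ≡ y [ZMOD M]) ↔ z ≡ u [ZMOD (N * M : ℕ)] := by
    intro x y
    obtain ⟨s, t, hst⟩ := Nat.isCoprime_iff_coprime.2 h
    refine ⟨y * (s * N) + x * (t * M), fun z => ?_⟩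
    have hx : y * (s * N) + x * (t * M) ≡ x [ZMOD N] := by
      rw [Int.modEq_iff_dvd]
      refine ⟨s * (x - y), ?_⟩
      linear_combination -x * hst
    have hy : y * (s * N) + x * (t * M) ≡ y [ZMOD M] := by
      rw [Int.modEq_iff_dvd]
      refine ⟨t * (y - x), ?_⟩
      linear_combination -y * hst
    rw [Nat.cast_mul, ← Int.modEq_and_modEq_iff_modEq_mul (by simpa using h)]
    exact ⟨fun hz => ⟨hz.1.trans hx.symm, hz.2.trans hy.symm⟩,
      fun hz => ⟨hz.1.trans hx, hz.2.trans hy⟩⟩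
  obtain ⟨u, hu⟩ := crt a a'
  obtain ⟨v, hv⟩ := crt b b'
  refine ⟨u, v, ?_⟩
  ext z
  have h1 := hu z.1
  have h2 := hv z.2
  simp only [residueClass, Set.mem_inter_iff, Set.mem_ofPred_eq]
  rw [← h1, ← h2]
  tauto

variable {R : ℝ → Finset (ℤ × ℤ)} {c : ℝ}

/-- The auxiliary class modulo N carries the induction: when p is added, the statement for P with
modulus N·p^k says that the points already selected are equidistributed modulo powers of p, which is
what the p-adic criterion needs. -/
theorem tendsto_pointDensity_forall_mem_finset (hR : IsEquidistributed R c)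
    {W : ∀ p : Nat.Primes, Set (ℤ_[p] × ℤ_[p])}
    (hW : ∀ p : Nat.Primes, padicPlaneMeasure p (frontier (W p)) = 0) (P : Finset Nat.Primes) :
    ∀ N : ℕ, 0 < N → (∀ p ∈ P, N.Coprime p) → ∀ a b : ℤ,
      Tendsto (pointDensity R ({z | ∀ p ∈ P, intPair p z ∈ W p} ∩ residueClass N a b)) atTop
        (𝓝 (c * (∏ p ∈ P, (padicPlaneMeasure p).real (W p)) / (N : ℝ) ^ 2)) := by
  classical
  induction P using Finset.induction_on with
  | empty =>
    intro N hN _ a b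
    simpa using hR N hN a b
  | insert p P hp ih =>
    intro N hN hcop a b
    have hpN : N.Coprime p := hcop p (Finset.mem_insert_self _ _)
    set S := {z : ℤ × ℤ | ∀ q ∈ P, intPair q z ∈ W q} ∩ residueClass N a b with hS
    have key := tendsto_pointDensity_of_frontier_null (p := p)
      (R := restrictTo R S)
      (c := c * (∏ q ∈ P, (padicPlaneMeasure q).real (W q)) / (N : ℝ) ^ 2) ?_ (hW p)
    · rw [pointDensity_restrictTo] at key
      have e : S ∩ {z | intPair p z ∈ W p} =
          {z | ∀ q ∈ insert p P, intPair q z ∈ W q} ∩ residueClass N a b := by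
        ext z
        simp only [hS, Set.mem_inter_iff, Set.mem_ofPred_eq, Finset.forall_mem_insert]
        tauto
      rw [e] at key
      convert key using 2
      rw [Finset.prod_insert hp]
      ring
    · intro k a' b'
      rw [pointDensity_restrictTo, hS, Set.inter_assoc]
      obtain ⟨a'', b'', h⟩ := exists_residueClass_inter (hpN.pow_right k) a b a' b'
      have h' : residueClass N a b ∩ {z | z.1 ≡ a' [ZMOD (p ^ k : ℕ)] ∧ z.2 ≡ b' [ZMOD (p ^ k : ℕ)]}
          = residueClass (N * p ^ k) a'' b'' := h
      rw [h']
      convert ih (N * p ^ k) (Nat.mul_pos hN (pow_pos p.2.pos k)) ?_ a'' b'' using 2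
      · push_cast; rw [div_div, mul_pow]
      · intro q hq
        refine Nat.Coprime.mul_left (hcop q (Finset.mem_insert_of_mem hq)) (Nat.Coprime.pow_left k ?_)
        refine (Nat.coprime_primes p.2 q.2).2 fun h => hp ?_
        rwa [Subtype.ext h]

/-- Finite products decrease as the index set grows and stay nonnegative, so they converge to their
infimum, possibly 0. -/
theorem hasProd_of_mem_unitInterval {ι : Type*} {f : ι → ℝ} (h0 : ∀ i, 0 ≤ f i)
    (h1 : ∀ i, f i ≤ 1) : HasProd f (⨅ s : Finset ι, ∏ i ∈ s, f i) := by
  have : Tendsto (fun s : Finset ι => ∏ i ∈ s, f i) atTop (𝓝 (⨅ s : Finset ι, ∏ i ∈ s, f i)) := by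
    refine tendsto_atTop_ciInf (fun s t hst => ?_) ⟨0, ?_⟩
    · exact Finset.prod_le_prod_of_subset_of_le_one hst (fun i _ => h0 i) fun i _ _ => h1 i
    · rintro _ ⟨s, rfl⟩
      exact Finset.prod_nonneg fun i _ => h0 i
  simpa [HasProd] using this

theorem multipliable_measureReal (W : ∀ p : Nat.Primes, Set (ℤ_[p] × ℤ_[p])) :
    Multipliable fun p : Nat.Primes => (padicPlaneMeasure p).real (W p) :=
  ⟨_, hasProd_of_mem_unitInterval (fun _ => measureReal_nonneg) fun _ => measureReal_le_one⟩

/-- The sieve: if the conditions at large primes rarely fail, the density of the points satisfying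
all the local conditions is the product of the local densities. -/
theorem tendsto_pointDensity_forall_mem (hR : IsEquidistributed R c)
    {W : ∀ p : Nat.Primes, Set (ℤ_[p] × ℤ_[p])}
    (hW : ∀ p : Nat.Primes, padicPlaneMeasure p (frontier (W p)) = 0)
    (htail : ∀ ε > 0, ∃ M₀ : ℕ, ∀ M ≥ M₀, ∀ᶠ X in atTop,
      pointDensity R {z | ∃ p : Nat.Primes, M < p ∧ intPair p z ∉ W p} X ≤ ε) :
    Tendsto (pointDensity R {z | ∀ p : Nat.Primes, intPair p z ∈ W p}) atTop
      (𝓝 (c * ∏' p : Nat.Primes, (padicPlaneMeasure p).real (W p))) := by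
  have hprod : Tendsto (fun s : Finset Nat.Primes => ∏ p ∈ s, (padicPlaneMeasure p).real (W p))
      atTop (𝓝 (∏' p : Nat.Primes, (padicPlaneMeasure p).real (W p))) := by
    simpa [HasProd] using (multipliable_measureReal W).hasProd
  rw [Metric.tendsto_atTop']
  intro ε hε
  obtain ⟨s, hs⟩ := Metric.tendsto_atTop.1 (hprod.const_mul c) (ε / 3) (by positivity)
  obtain ⟨M₀, hM₀⟩ := htail (ε / 3) (by positivity)
  -- M must be past the threshold of the tail bound and also so large that the primes up to M
  -- include s, where the partial product is already close to its limit.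
  set M := max M₀ (s.sup fun p => (p : ℕ)) with hM
  have hfin : {p : Nat.Primes | (p : ℕ) ≤ M}.Finite :=
    (Set.finite_Iic M).preimage (Subtype.val_injective.injOn)
  set P := hfin.toFinset with hP
  have hsP : s ⊆ P := fun p hp => by
    rw [hP, Set.Finite.mem_toFinset]
    exact (Finset.le_sup (f := fun p : Nat.Primes => (p : ℕ)) hp).trans (le_max_right _ _)
  have h1 := hs P hsP
  have h2 := tendsto_pointDensity_forall_mem_finset hR hW P 1 one_pos
    (fun _ _ => Nat.coprime_one_left _) 0 0
  have e : {z : ℤ × ℤ | ∀ p ∈ P, intPair p z ∈ W p} ∩ residueClass 1 0 0 =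
      {z | ∀ p ∈ P, intPair p z ∈ W p} := by
    refine Set.inter_eq_left.2 fun z _ => ?_
    simp only [residueClass, Set.mem_ofPred_eq, Nat.cast_one]
    exact ⟨Int.modEq_one, Int.modEq_one⟩
  rw [e] at h2
  simp only [Nat.cast_one, one_pow, div_one] at h2
  obtain ⟨X₀, hX₀⟩ := Metric.tendsto_atTop'.1 h2 (ε / 3) (by positivity)
  obtain ⟨X₁, hX₁⟩ := eventually_atTop.1 (hM₀ M (le_max_left _ _))
  refine ⟨max X₀ X₁, fun X hX => ?_⟩
  have h3 := hX₀ X ((le_max_left _ _).trans_lt hX)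
  have h4 := hX₁ X ((le_max_right _ _).trans hX.le)
  have h5 : pointDensity R {z | ∀ p : Nat.Primes, intPair p z ∈ W p} X ≤
      pointDensity R {z | ∀ p ∈ P, intPair p z ∈ W p} X :=
    pointDensity_mono R (by intro z hz p _; exact hz p) X
  have h6 : pointDensity R {z | ∀ p ∈ P, intPair p z ∈ W p} X ≤
      pointDensity R {z | ∀ p : Nat.Primes, intPair p z ∈ W p} X +
      pointDensity R {z | ∃ p : Nat.Primes, M < p ∧ intPair p z ∉ W p} X := by
    refine pointDensity_union_le R (fun z hz => ?_) X
    by_cases h : ∀ p : Nat.Primes, intPair p z ∈ W p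
    · exact Or.inl h
    · push Not at h
      obtain ⟨p, hp⟩ := h
      refine Or.inr ⟨p, ?_, hp⟩
      by_contra hle
      exact hp (hz p (by rw [hP, Set.Finite.mem_toFinset]; exact not_lt.1 hle))
  rw [Real.dist_eq, abs_lt] at *
  constructor <;> linarith

/-! ### Height boxes and the sign of the discriminant. -/

/-- The lattice points `(I, J)` of height less than `X`. -/
noncomputable def heightBox (X : ℝ) : Finset (ℤ × ℤ) :=
  Finset.Ioc (-⌈3 * X⌉) (⌈3 * X⌉ - 1) ×ˢ Finset.Ioc (-⌈27 * X⌉) (⌈27 * X⌉ - 1)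

theorem mem_Ioc_ceil_iff (a : ℤ) (x : ℝ) :
    a ∈ Finset.Ioc (-⌈x⌉) (⌈x⌉ - 1) ↔ |(a : ℝ)| < x := by
  have h : -x < (a : ℝ) ↔ -a < ⌈x⌉ := by rw [Int.lt_ceil, Int.cast_neg, neg_lt]
  rw [Finset.mem_Ioc, abs_lt, ← Int.lt_ceil, h]
  omega

theorem mem_heightBox_iff (z : ℤ × ℤ) (X : ℝ) :
    z ∈ heightBox X ↔ |(z.1 : ℝ)| < 3 * X ∧ |(z.2 : ℝ)| < 27 * X := by
  rw [heightBox, Finset.mem_product, mem_Ioc_ceil_iff, mem_Ioc_ceil_iff]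

theorem heightBox_subset_square (X : ℝ) : heightBox X ⊆ square ⌈27 * X⌉₊ := by
  intro z hz
  rw [mem_heightBox_iff] at hz
  have h : ∀ a : ℤ, |(a : ℝ)| < 27 * X → a ∈ symmInterval ⌈27 * X⌉₊ := by
    intro a ha
    have h1 : |(a : ℝ)| ≤ (⌈27 * X⌉₊ : ℝ) := ha.le.trans (Nat.le_ceil _)
    have h2 : |a| ≤ (⌈27 * X⌉₊ : ℤ) := by exact_mod_cast h1
    exact Finset.mem_Icc.2 (abs_le.1 h2)
  have hX : 0 ≤ X := by
    have := abs_nonneg (z.1 : ℝ)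
    linarith [hz.1]
  exact Finset.mem_product.2 ⟨h _ (hz.1.trans_le (by linarith)), h _ hz.2⟩

/-- A bound for a set of lattice points in squares bounds its density in height boxes. -/
theorem eventually_pointDensity_heightBox_le {S : Set (ℤ × ℤ)} {ε : ℝ} (hε : 0 ≤ ε)
    (R : ℝ → Finset (ℤ × ℤ)) (hR : ∀ X, R X ⊆ heightBox X) {Q : ℤ × ℤ → Prop} [DecidablePred Q]
    (hSQ : ∀ z ∈ S, Q z)
    (h : ∀ᶠ Y : ℕ in atTop, (((square Y).filter Q).card : ℝ) ≤ ε * Y ^ 2) :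
    ∀ᶠ X in atTop, pointDensity R S X ≤ 784 * ε := by
  classical
  have h1 : Tendsto (fun X : ℝ => ⌈27 * X⌉₊) atTop atTop :=
    tendsto_nat_ceil_atTop.comp (tendsto_id.const_mul_atTop (by norm_num))
  filter_upwards [h1.eventually h, eventually_ge_atTop 1] with X hX hX1
  unfold pointDensity
  rw [div_le_iff₀ (by positivity)]
  have h2 : ((R X).filter (· ∈ S)).card ≤ ((square ⌈27 * X⌉₊).filter Q).card := by
    refine Finset.card_le_card fun z hz => ?_
    rw [Finset.mem_filter] at hz ⊢
    exact ⟨heightBox_subset_square X (hR X hz.1), hSQ z hz.2⟩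
  -- The factor 784 is 28²; X ≥ 1 absorbs the rounding.
  have h3 : (⌈27 * X⌉₊ : ℝ) ≤ 28 * X := by
    have := Nat.ceil_lt_add_one (by positivity : 0 ≤ 27 * X)
    linarith
  calc _ ≤ (((square ⌈27 * X⌉₊).filter Q).card : ℝ) := by exact_mod_cast h2
    _ ≤ ε * (⌈27 * X⌉₊ : ℝ) ^ 2 := hX
    _ ≤ ε * (28 * X) ^ 2 := by gcongr
    _ = _ := by ring

theorem tendsto_card_Ioc_modEq_div {l u : ℝ → ℤ} {α : ℝ} (hlu : ∀ᶠ X in atTop, l X ≤ u X)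
    (h : Tendsto (fun X => ((u X : ℝ) - l X) / X) atTop (𝓝 α)) {N : ℕ} (hN : 0 < N) (v : ℤ) :
    Tendsto (fun X => (((Finset.Ioc (l X) (u X)).filter (fun x => x ≡ v [ZMOD N])).card : ℝ) / X)
      atTop (𝓝 (α / N)) := by
  have h1 : Tendsto (fun X => ((u X : ℝ) - l X) / X / N) atTop (𝓝 (α / N)) := h.div_const _
  have h2 : Tendsto (fun X : ℝ => 1 / X) atTop (𝓝 0) := by
    simpa using tendsto_inv_atTop_zero (𝕜 := ℝ)
  have h3 : Tendsto (fun X => (((Finset.Ioc (l X) (u X)).filter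
      (fun x => x ≡ v [ZMOD N])).card : ℝ) / X - ((u X : ℝ) - l X) / X / N) atTop (𝓝 0) := by
    refine squeeze_zero_norm' ?_ h2
    filter_upwards [hlu, eventually_gt_atTop 0] with X hX hX0
    have := abs_card_Ioc_modEq_sub_le hX hN v
    rw [Real.norm_eq_abs, div_right_comm, ← sub_div, abs_div, abs_of_pos hX0]
    gcongr
  simpa using h3.add h1

theorem tendsto_ceil_mul_div {a : ℝ} (ha : 0 ≤ a) :
    Tendsto (fun X : ℝ => (⌈a * X⌉ : ℝ) / X) atTop (𝓝 a) := by
  have h := (tendsto_nat_ceil_mul_div_atTop (R := ℝ) ha)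
  refine h.congr' ?_
  filter_upwards [eventually_ge_atTop 0] with X hX
  rw [← natCast_ceil_eq_intCast_ceil (by positivity : 0 ≤ a * X)]

theorem tendsto_const_div_atTop_zero (a : ℝ) : Tendsto (fun X : ℝ => a / X) atTop (𝓝 0) :=
  tendsto_const_nhds.div_atTop tendsto_id

/-- The lattice points `(I, J)` of height less than `X` for which `4 I³ - J²` has the sign `s`. -/
noncomputable def signBox (s : ℤ) (X : ℝ) : Finset (ℤ × ℤ) :=
  (heightBox X).filter fun z => 0 < s * (4 * z.1 ^ 3 - z.2 ^ 2)

theorem signBox_subset (s : ℤ) (X : ℝ) : signBox s X ⊆ heightBox X := Finset.filter_subset _ _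

/-- Here 4a³ ≤ b² ≤ Y² forces a to be O(Y^(2/3)), hence at most δY for large Y. -/
theorem eventually_card_cube_le_sq_le {ε : ℝ} (hε : 0 < ε) :
    ∀ᶠ Y : ℕ in atTop, (((square Y).filter
      (fun z : ℤ × ℤ => 0 ≤ z.1 ∧ 4 * z.1 ^ 3 ≤ z.2 ^ 2)).card : ℝ) ≤ ε * Y ^ 2 := by
  set δ : ℝ := ε / 12 with hδ
  have hδ0 : 0 < δ := by positivity
  filter_upwards [(tendsto_natCast_atTop_atTop (R := ℝ)).eventually
    (eventually_ge_atTop (max (6 / ε) (1 / (4 * δ ^ 3)))), eventually_ge_atTop 1] with Y hbig hY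
  have hYR : (1 : ℝ) ≤ Y := by exact_mod_cast hY
  have hY6 : 6 ≤ ε * Y := by
    have := (le_max_left _ _).trans hbig
    rw [div_le_iff₀ hε] at this; linarith
  have hYδ : 1 ≤ 4 * δ ^ 3 * Y := by
    have := (le_max_right _ _).trans hbig
    rw [div_le_iff₀ (by positivity)] at this; linarith
  have hsub : (square Y).filter (fun z : ℤ × ℤ => 0 ≤ z.1 ∧ 4 * z.1 ^ 3 ≤ z.2 ^ 2) ⊆
      (square Y).filter (fun z : ℤ × ℤ => |(z.1 : ℝ)| ≤ δ * Y) := by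
    rintro ⟨a, b⟩ hz
    simp only [Finset.mem_filter, Finset.mem_product, Finset.mem_Icc] at hz ⊢
    refine ⟨hz.1, ?_⟩
    have ha : (0 : ℝ) ≤ a := by exact_mod_cast hz.2.1
    have hab : 4 * (a : ℝ) ^ 3 ≤ b ^ 2 := by exact_mod_cast hz.2.2
    have hb1 : -(Y : ℝ) ≤ b := by exact_mod_cast hz.1.2.1
    have hb2 : (b : ℝ) ≤ Y := by exact_mod_cast hz.1.2.2
    rw [abs_of_nonneg ha]
    by_contra! hlt
    have h1 : (δ * Y) ^ 3 < (a : ℝ) ^ 3 := by gcongr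
    have h2 : (b : ℝ) ^ 2 ≤ Y ^ 2 := sq_le_sq' hb1 hb2
    have h3 : 1 * (Y : ℝ) ^ 2 ≤ 4 * δ ^ 3 * Y * Y ^ 2 :=
      mul_le_mul_of_nonneg_right hYδ (by positivity)
    linarith [mul_pow δ (Y : ℝ) 3]
  have h1 := (Nat.cast_le (α := ℝ).2 (Finset.card_le_card hsub)).trans (card_small_fst_le hδ0.le)
  refine h1.trans ?_
  calc _ ≤ (2 * δ * (Y : ℝ) + 1) * (3 * Y) := by gcongr; linarith
    _ = ε / 2 * Y ^ 2 + 3 * Y := by rw [hδ]; ring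
    _ ≤ _ := by
      have h : 6 * (Y : ℝ) ≤ ε * Y * Y := mul_le_mul_of_nonneg_right hY6 (by positivity)
      linarith

theorem tendsto_pointDensity_cube_le_sq :
    Tendsto (pointDensity heightBox {z | 0 ≤ z.1 ∧ 4 * z.1 ^ 3 ≤ z.2 ^ 2}) atTop (𝓝 0) := by
  rw [Metric.tendsto_atTop']
  intro ε hε
  obtain ⟨X₀, hX₀⟩ := eventually_atTop.1 (eventually_pointDensity_heightBox_le
    (S := {z | 0 ≤ z.1 ∧ 4 * z.1 ^ 3 ≤ z.2 ^ 2}) (by positivity : 0 ≤ ε / 1000) heightBox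
    (fun X => subset_rfl) (fun z hz => hz) (eventually_card_cube_le_sq_le (by positivity)))
  refine ⟨X₀, fun X hX => ?_⟩
  rw [Real.dist_eq, sub_zero, abs_of_nonneg (pointDensity_nonneg _ _ _)]
  have := hX₀ X hX.le
  linarith

/-- The lattice points of a rectangle are equidistributed. -/
theorem isEquidistributed_Ioc_product {l u l' u' : ℝ → ℤ} {α β : ℝ}
    (hlu : ∀ᶠ X in atTop, l X ≤ u X) (h : Tendsto (fun X => ((u X : ℝ) - l X) / X) atTop (𝓝 α))
    (hlu' : ∀ᶠ X in atTop, l' X ≤ u' X)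
    (h' : Tendsto (fun X => ((u' X : ℝ) - l' X) / X) atTop (𝓝 β)) :
    IsEquidistributed (fun X => Finset.Ioc (l X) (u X) ×ˢ Finset.Ioc (l' X) (u' X)) (α * β) := by
  intro N hN a b
  have h1 := (tendsto_card_Ioc_modEq_div hlu h hN a).mul (tendsto_card_Ioc_modEq_div hlu' h' hN b)
  rw [div_mul_div_comm, ← sq] at h1
  refine h1.congr fun X => ?_
  unfold pointDensity
  rw [div_mul_div_comm, ← sq, ← Nat.cast_mul, ← Finset.card_product, ← Finset.filter_product]
  congr!

theorem tendsto_Ioc_ceil (a : ℝ) (ha : 0 ≤ a) :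
    Tendsto (fun X : ℝ => (((⌈a * X⌉ - 1 : ℤ) : ℝ) - (0 : ℤ)) / X) atTop (𝓝 a) := by
  have h := (tendsto_ceil_mul_div ha).sub (tendsto_const_div_atTop_zero 1)
  rw [sub_zero] at h
  refine h.congr fun X => ?_
  push_cast; ring

theorem tendsto_Ioc_neg_ceil (a : ℝ) (ha : 0 ≤ a) :
    Tendsto (fun X : ℝ => (((-1 : ℤ) : ℝ) - (-⌈a * X⌉ : ℤ)) / X) atTop (𝓝 a) := by
  have h := (tendsto_ceil_mul_div ha).sub (tendsto_const_div_atTop_zero 1)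
  rw [sub_zero] at h
  refine h.congr fun X => ?_
  push_cast; ring

theorem tendsto_Ioc_neg_ceil_ceil (a : ℝ) (ha : 0 ≤ a) :
    Tendsto (fun X : ℝ => (((⌈a * X⌉ - 1 : ℤ) : ℝ) - (-⌈a * X⌉ : ℤ)) / X) atTop (𝓝 (2 * a)) := by
  have h := (((tendsto_ceil_mul_div ha).const_mul 2).sub (tendsto_const_div_atTop_zero 1))
  rw [sub_zero] at h
  refine h.congr fun X => ?_
  push_cast; ring

theorem eventually_one_le_ceil {a : ℝ} (ha : 0 < a) : ∀ᶠ X : ℝ in atTop, 1 ≤ ⌈a * X⌉ := by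
  filter_upwards [eventually_gt_atTop 0] with X hX
  exact Int.one_le_ceil_iff.2 (by positivity)

/-- The half of the height box in which `I` has the sign `s`. -/
theorem isEquidistributed_half {s : ℤ} (hs : s = 1 ∨ s = -1) :
    IsEquidistributed (fun X => (heightBox X).filter fun z => 0 < s * z.1) 162 := by
  have e : (162 : ℝ) = 3 * (2 * 27) := by norm_num
  have h27 := eventually_one_le_ceil (a := 27) (by norm_num)
  have h3 := eventually_one_le_ceil (a := 3) (by norm_num)
  have h27' : ∀ᶠ X : ℝ in atTop, -⌈27 * X⌉ ≤ ⌈27 * X⌉ - 1 := by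
    filter_upwards [h27] with X hX; omega
  rw [e]
  rcases hs with rfl | rfl
  · have key := isEquidistributed_Ioc_product (l := fun _ => 0) (u := fun X => ⌈3 * X⌉ - 1)
      (by filter_upwards [h3] with X hX; omega) (tendsto_Ioc_ceil 3 (by norm_num)) h27'
      (tendsto_Ioc_neg_ceil_ceil 27 (by norm_num))
    have : (fun X => (heightBox X).filter fun z => 0 < 1 * z.1) = fun X : ℝ =>
        Finset.Ioc 0 (⌈3 * X⌉ - 1) ×ˢ Finset.Ioc (-⌈27 * X⌉) (⌈27 * X⌉ - 1) := by
      ext X z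
      simp only [heightBox, Finset.mem_filter, Finset.mem_product, Finset.mem_Ioc]
      omega
    rwa [this]
  · have key := isEquidistributed_Ioc_product (l := fun X => -⌈3 * X⌉) (u := fun _ => -1)
      (by filter_upwards [h3] with X hX; omega) (tendsto_Ioc_neg_ceil 3 (by norm_num)) h27'
      (tendsto_Ioc_neg_ceil_ceil 27 (by norm_num))
    have : (fun X => (heightBox X).filter fun z => 0 < -1 * z.1) = fun X : ℝ =>
        Finset.Ioc (-⌈3 * X⌉) (-1) ×ˢ Finset.Ioc (-⌈27 * X⌉) (⌈27 * X⌉ - 1) := by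
      ext X z
      simp only [heightBox, Finset.mem_filter, Finset.mem_product, Finset.mem_Ioc]
      omega
    rwa [this]

/-- Off the density-zero set E, the sign of 4I³ - J² agrees with that of I, so the densities are
those of a half box, which is a rectangle. -/
theorem isEquidistributed_signBox {s : ℤ} (hs : s = 1 ∨ s = -1) :
    IsEquidistributed (signBox s) 162 := by
  classical
  intro N hN a b
  set E : Set (ℤ × ℤ) := {z | 0 ≤ z.1 ∧ 4 * z.1 ^ 3 ≤ z.2 ^ 2} with hE
  set S : Set (ℤ × ℤ) := {z | 0 < s * (4 * z.1 ^ 3 - z.2 ^ 2)} with hS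
  set T : Set (ℤ × ℤ) := {z | 0 < s * z.1} with hT
  set C := residueClass N a b
  have h1 := isEquidistributed_half hs N hN a b
  have e1 : (fun X => (heightBox X).filter fun z => 0 < s * z.1) =
      restrictTo heightBox T := by
    ext X z; simp [hT, restrictTo]
  have e2 : signBox s = restrictTo heightBox S := by
    ext X z; simp [hS, signBox, restrictTo]
  have e1' : pointDensity (fun X => (heightBox X).filter fun z => 0 < s * z.1) C =
      pointDensity heightBox (T ∩ C) := by
    rw [e1, pointDensity_restrictTo]
  have e2' : pointDensity (signBox s) C = pointDensity heightBox (S ∩ C) := by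
    rw [e2, pointDensity_restrictTo]
  rw [e1'] at h1
  rw [e2']
  have hcase : ∀ z : ℤ × ℤ, z ∉ E → (z ∈ S ↔ z ∈ T) := by
    intro z hz
    simp only [hE, hS, hT, Set.mem_ofPred_eq, not_and, not_le] at hz ⊢
    have hsq := sq_nonneg z.2
    have hneg : z.1 < 0 → 4 * z.1 ^ 3 < 0 := fun h => by
      have := Odd.pow_neg (n := 3) (by decide) h
      linarith
    rcases lt_or_ge z.1 0 with h | h
    · have := hneg h
      rcases hs with rfl | rfl <;> constructor <;> intro <;> linarith
    · have h3 := hz h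
      have h4 : z.1 ≠ 0 := by
        intro h0; rw [h0] at h3; norm_num at h3; linarith
      have h5 : 0 < z.1 := lt_of_le_of_ne h h4.symm
      rcases hs with rfl | rfl <;> constructor <;> intro <;> linarith
  have hST : S ∩ C ⊆ T ∩ C ∪ E := fun z hz => by
    by_cases h : z ∈ E
    · exact Or.inr h
    · exact Or.inl ⟨(hcase z h).1 hz.1, hz.2⟩
  have hTS : T ∩ C ⊆ S ∩ C ∪ E := fun z hz => by
    by_cases h : z ∈ E
    · exact Or.inr h
    · exact Or.inl ⟨(hcase z h).2 hz.1, hz.2⟩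
  have h0 := tendsto_pointDensity_cube_le_sq
  refine tendsto_of_tendsto_of_tendsto_of_le_of_le (by simpa using h1.sub h0)
    (by simpa using h1.add h0) (fun X => ?_) (fun X => pointDensity_union_le _ hST X)
  have := pointDensity_union_le heightBox hTS X
  linarith

/-- The density of the points satisfying local conditions, which at large primes are implied by
`p² ∤ 4 I³ - J²`. -/
theorem tendsto_pointDensity_signBox {s : ℤ} (hs : s = 1 ∨ s = -1)
    {W : ∀ p : Nat.Primes, Set (ℤ_[p] × ℤ_[p])}
    (hW : ∀ p : Nat.Primes, padicPlaneMeasure p (frontier (W p)) = 0) {p₀ : ℕ}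
    (hlarge : ∀ p : Nat.Primes, p₀ < p → ∀ z : ℤ × ℤ, intPair p z ∉ W p →
      ((p : ℕ) : ℤ) ^ 2 ∣ 4 * z.1 ^ 3 - z.2 ^ 2) :
    Tendsto (pointDensity (signBox s) {z | ∀ p : Nat.Primes, intPair p z ∈ W p}) atTop
      (𝓝 (162 * ∏' p : Nat.Primes, (padicPlaneMeasure p).real (W p))) := by
  classical
  refine tendsto_pointDensity_forall_mem (isEquidistributed_signBox hs) hW fun ε hε => ?_
  obtain ⟨M₀, hM₀⟩ := exists_card_large_square_divisor_le (by positivity : 0 < ε / 784)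
  refine ⟨max M₀ p₀, fun M hM => ?_⟩
  have key := eventually_pointDensity_heightBox_le
    (S := {z | ∃ p : Nat.Primes, M < p ∧ intPair p z ∉ W p}) (by positivity : 0 ≤ ε / 784)
    (signBox s) (signBox_subset s) ?_ (hM₀ M ((le_max_left _ _).trans hM))
  · filter_upwards [key] with X hX
    linarith
  · rintro z ⟨p, hp, hz⟩
    exact ⟨p, p.2, hp, hlarge p (((le_max_right _ _).trans hM).trans_lt hp) z hz⟩

/-! ### Local conditions and minimality in ℤ_p². -/

section Local

variable (p : ℕ) [Fact p.Prime]

theorem isOpen_toZModPow_fiber (k : ℕ) (r : ZMod (p ^ k)) :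
    IsOpen {x : ℤ_[p] | PadicInt.toZModPow k x = r} := by
  obtain ⟨y, rfl⟩ := ZMod.ringHom_surjective (PadicInt.toZModPow (p := p) k) r
  simp_rw [toZModPow_eq_iff, PadicInt.norm_le_pow_iff_norm_lt_pow_add_one, ← dist_eq_norm]
  exact Metric.isOpen_ball

theorem isClopen_toZModPow_fiber (k : ℕ) (r : ZMod (p ^ k)) :
    IsClopen {x : ℤ_[p] | PadicInt.toZModPow k x = r} :=
  ⟨isClosed_toZModPow_fiber p k r, isOpen_toZModPow_fiber p k r⟩

theorem isClopen_reduction_fiber (k : ℕ) (t : ZMod (p ^ k) × ZMod (p ^ k)) :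
    IsClopen {x | reduction p k x = t} := by
  have : {x | reduction p k x = t} = {x : ℤ_[p] | PadicInt.toZModPow k x = t.1} ×ˢ
      {x : ℤ_[p] | PadicInt.toZModPow k x = t.2} := by
    ext x; simp [reduction, Prod.ext_iff]
  rw [this]
  exact (isClopen_toZModPow_fiber p k _).prod (isClopen_toZModPow_fiber p k _)

/-- Up to a unit n is a power of p, so divisibility by n is a congruence modulo that power. -/
theorem isClopen_setOf_dvd {n : ℤ_[p]} (hn : n ≠ 0) : IsClopen {x : ℤ_[p] | n ∣ x} := by
  convert isClopen_toZModPow_fiber p n.valuation 0 using 1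
  ext x
  simp only [Set.mem_ofPred_eq]
  rw [← RingHom.mem_ker, PadicInt.ker_toZModPow, Ideal.mem_span_singleton]
  nth_rewrite 1 [PadicInt.unitCoeff_spec hn]
  exact (PadicInt.unitCoeff hn).isUnit.mul_left_dvd

/-- The pairs `(I, J)` that are `p`-adically of the form `(-3A, -27B)` with `p⁴ ∤ A` or `p⁶ ∤ B`. -/
def minimalPairs : Set (ℤ_[p] × ℤ_[p]) :=
  {x | (3 ∣ x.1 ∧ 27 ∣ x.2) ∧ ¬ (3 * (p : ℤ_[p]) ^ 4 ∣ x.1 ∧ 27 * (p : ℤ_[p]) ^ 6 ∣ x.2)}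

theorem isClopen_minimalPairs : IsClopen (minimalPairs p) := by
  have hp : (p : ℤ_[p]) ≠ 0 := by exact_mod_cast (Fact.out : p.Prime).ne_zero
  have h : ∀ {m n : ℤ_[p]}, m ≠ 0 → n ≠ 0 →
      IsClopen {x : ℤ_[p] × ℤ_[p] | m ∣ x.1 ∧ n ∣ x.2} := fun hm hn =>
    (isClopen_setOf_dvd p hm).prod (isClopen_setOf_dvd p hn)
  exact (h (by norm_num) (by norm_num)).inter (h (mul_ne_zero (by norm_num) (pow_ne_zero _ hp))
    (mul_ne_zero (by norm_num) (pow_ne_zero _ hp))).compl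

variable {p}

theorem frontier_inter_minimalPairs_null {S : Set (ℤ_[p] × ℤ_[p])} (hS : IsLocalCondition p S) :
    padicPlaneMeasure p (frontier (S ∩ minimalPairs p)) = 0 := by
  refine measure_mono_null ?_ hS.frontier_null
  refine (frontier_inter_subset _ _).trans ?_
  rw [(isClopen_minimalPairs p).frontier_eq, Set.inter_empty, Set.union_empty]
  exact Set.inter_subset_left

theorem padicDisc_intPair (z : ℤ × ℤ) :
    padicDisc p (intPair p z) = ((4 * z.1 ^ 3 - z.2 ^ 2 : ℤ) : ℚ_[p]) / 27 := by
  simp [padicDisc, disc, intPair]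

theorem padicDisc_intPair_ne_zero_iff (z : ℤ × ℤ) :
    padicDisc p (intPair p z) ≠ 0 ↔ 4 * z.1 ^ 3 - z.2 ^ 2 ≠ 0 := by
  rw [padicDisc_intPair, Ne, div_eq_zero_iff, Int.cast_eq_zero]
  norm_num

/-- Multiplying by 27 stays in ℤ_p, so this direction is valid even at p = 3, where the converse can
fail. -/
theorem sq_dvd_of_padicDisc_eq {z : ℤ × ℤ} {d : ℤ_[p]}
    (h : padicDisc p (intPair p z) = (p : ℚ_[p]) ^ 2 * d) :
    (p : ℤ) ^ 2 ∣ 4 * z.1 ^ 3 - z.2 ^ 2 := by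
  rw [padicDisc_intPair, div_eq_iff (by norm_num)] at h
  have h2 : ((4 * z.1 ^ 3 - z.2 ^ 2 : ℤ) : ℤ_[p]) = (p : ℤ_[p]) ^ 2 * (d * (27 : ℕ)) := by
    apply PadicInt.ext
    rw [PadicInt.coe_intCast, h]
    simp only [PadicInt.coe_mul, PadicInt.coe_pow, PadicInt.coe_natCast]
    push_cast
    ring
  exact (PadicInt.pow_p_dvd_int_iff 2 _).1 ⟨_, h2⟩

/-- S is closed away from Δ = 0 and minimality is a closed condition, so neither is lost on passing
to limits with Δ ≠ 0. -/
theorem invAt_subset {S : Set (ℤ_[p] × ℤ_[p])} (hS : IsLocalCondition p S) {F : Set EllCurve}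
    (hF : ∀ E ∈ F, E.padicInv p ∈ S ∩ minimalPairs p) : invAt p F ⊆ S ∩ minimalPairs p := by
  obtain ⟨C, hC, hSC⟩ := hS.closed
  rintro x ⟨hx, hx0⟩
  have h : closure ((fun E => E.padicInv p) '' F) ⊆ C ∩ minimalPairs p := by
    refine closure_minimal ?_ (hC.inter (isClopen_minimalPairs p).1)
    rintro _ ⟨E, hE, rfl⟩
    have := hF E hE
    rw [hSC] at this
    exact ⟨this.1.1, this.2⟩
  rw [hSC]
  exact ⟨⟨(h hx).1, hx0⟩, (h hx).2⟩

end Local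

/-! ### Elliptic curves as lattice points. -/

theorem four_mul_I_pow_sub (A B : ℤ) :
    (4 * (-3 * A) ^ 3 - (-27 * B) ^ 2 : ℤ) = -27 * (4 * A ^ 3 + 27 * B ^ 2) := by ring

theorem isElliptic_iff (A B : ℤ) :
    (shortWeierstrass A B).IsElliptic ↔ 4 * A ^ 3 + 27 * B ^ 2 ≠ 0 := by
  have h : (shortWeierstrass A B).Δ = ((-16 * (4 * A ^ 3 + 27 * B ^ 2) : ℤ) : ℚ) := by
    simp only [shortWeierstrass, WeierstrassCurve.Δ, WeierstrassCurve.b₂, WeierstrassCurve.b₄,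
      WeierstrassCurve.b₆, WeierstrassCurve.b₈]
    push_cast
    ring
  have h2 : (shortWeierstrass A B).IsElliptic ↔ (shortWeierstrass A B).Δ ≠ 0 :=
    ⟨fun h => h.isUnit.ne_zero, fun h => ⟨h.isUnit⟩⟩
  rw [h2, h, Int.cast_ne_zero]
  simp

theorem EllCurve.disc_ne_zero (E : EllCurve) : 4 * E.I ^ 3 - E.J ^ 2 ≠ 0 := by
  have := (isElliptic_iff E.A E.B).1 E.isElliptic
  rw [EllCurve.I, EllCurve.J, four_mul_I_pow_sub]
  exact mul_ne_zero (by norm_num) this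

theorem natCast_pow_dvd_neg_mul_iff (p : ℕ) [Fact p.Prime] (k : ℕ) {m : ℤ} (hm : m ≠ 0) (a : ℤ) :
    (m : ℤ_[p]) * (p : ℤ_[p]) ^ k ∣ ((-m * a : ℤ) : ℤ_[p]) ↔ (p : ℤ) ^ k ∣ a := by
  have : ((-m * a : ℤ) : ℤ_[p]) = (m : ℤ_[p]) * -(a : ℤ_[p]) := by push_cast; ring
  rw [this, mul_dvd_mul_iff_left (by exact_mod_cast hm), dvd_neg, PadicInt.pow_p_dvd_int_iff]

theorem intPair_mem_minimalPairs_iff (p : ℕ) [Fact p.Prime] (A B : ℤ) :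
    intPair p (-3 * A, -27 * B) ∈ minimalPairs p ↔ ¬ ((p : ℤ) ^ 4 ∣ A ∧ (p : ℤ) ^ 6 ∣ B) := by
  have h1 := natCast_pow_dvd_neg_mul_iff p 4 (m := 3) (by norm_num) A
  have h2 := natCast_pow_dvd_neg_mul_iff p 6 (m := 27) (by norm_num) B
  rw [Int.cast_ofNat] at h1 h2
  have h3 : (3 : ℤ_[p]) ∣ ((-3 * A : ℤ) : ℤ_[p]) := ⟨-A, by push_cast; ring⟩
  have h4 : (27 : ℤ_[p]) ∣ ((-27 * B : ℤ) : ℤ_[p]) := ⟨-B, by push_cast; ring⟩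
  simp only [minimalPairs, intPair, Set.mem_ofPred_eq, h1, h2, h3, h4, true_and]

/-- Being a curve is itself a local matter: the prime 3 gives 3 ∣ I and 27 ∣ J, and each p gives
minimality at p. -/
theorem exists_ellCurve_of_forall_mem {S : ∀ p : Nat.Primes, Set (ℤ_[p] × ℤ_[p])}
    (hS : ∀ p : Nat.Primes, IsLocalCondition p (S p)) {z : ℤ × ℤ}
    (hz : ∀ p : Nat.Primes, intPair p z ∈ S p ∩ minimalPairs p) :
    ∃ E : EllCurve, (E.I, E.J) = z := by
  obtain ⟨I, J⟩ := z
  have h3 := (hz ⟨3, Nat.prime_three⟩).2.1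
  obtain ⟨A, hA⟩ : (3 : ℤ) ∣ I := by
    have := (PadicInt.pow_p_dvd_int_iff (p := 3) 1 I).1 (by simpa [intPair] using h3.1)
    simpa using this
  obtain ⟨B, hB⟩ : (27 : ℤ) ∣ J := by
    have h : ((3 : ℕ) : ℤ_[3]) ^ 3 ∣ (J : ℤ_[3]) := by
      have := h3.2
      norm_num [intPair] at this ⊢
      exact this
    have := (PadicInt.pow_p_dvd_int_iff (p := 3) 3 J).1 h
    norm_num at this
    exact this
  obtain rfl : I = -3 * (-A) := by linarith
  obtain rfl : J = -27 * (-B) := by linarith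
  refine ⟨⟨-A, -B, ?_, fun p hp h6 h4 => ?_⟩, rfl⟩
  -- Any prime would do here, since every local condition excludes Δ = 0.
  · have h2 := (padicDisc_intPair_ne_zero_iff _).1
      ((hS ⟨2, Nat.prime_two⟩).disc_ne_zero _ (hz ⟨2, Nat.prime_two⟩).1)
    simp only [four_mul_I_pow_sub] at h2
    rw [isElliptic_iff]
    exact right_ne_zero_of_mul h2
  · have : Fact p.Prime := ⟨hp⟩
    exact (intPair_mem_minimalPairs_iff p (-A) (-B)).1 (hz ⟨p, hp⟩).2 ⟨h4, h6⟩

theorem EllCurve.padicInv_mem_minimalPairs (E : EllCurve) (p : ℕ) [hp : Fact p.Prime] :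
    E.padicInv p ∈ minimalPairs p :=
  (intPair_mem_minimalPairs_iff p E.A E.B).2 fun h => E.minimal p hp.out h.2 h.1

theorem EllCurve.height_lt_iff (E : EllCurve) (X : ℝ) :
    E.height < X ↔ (E.I, E.J) ∈ heightBox X := by
  rw [mem_heightBox_iff, EllCurve.height, heightIJ, max_lt_iff, div_lt_iff₀ (by norm_num),
    div_lt_iff₀ (by norm_num), mul_comm X, mul_comm X]

theorem injective_I_J : Function.Injective fun E : EllCurve => (E.I, E.J) := by
  intro E E' h
  simp only [Prod.mk.injEq, EllCurve.I, EllCurve.J] at h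
  exact EllCurve.ext (by omega) (by omega)

theorem disc_intCast (I J : ℤ) :
    disc (I : ℝ) (J : ℝ) = ((4 * I ^ 3 - J ^ 2 : ℤ) : ℝ) / 27 := by
  simp [disc]

theorem sign_mul_disc_pos_iff (s I J : ℤ) :
    0 < (s : ℝ) * disc (I : ℝ) (J : ℝ) ↔ 0 < s * (4 * I ^ 3 - J ^ 2) := by
  rw [disc_intCast, ← mul_div_assoc, ← Int.cast_mul, div_pos_iff_of_pos_right (by norm_num),
    Int.cast_pos]

/-- A condition at infinity is a condition on the sign of the discriminant. -/
theorem IsInfinityCondition.exists_sign {S : Set (ℝ × ℝ)} (hS : IsInfinityCondition S) :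
    ∃ q : ℤ → Prop, (∃ s : ℤ, (s = 1 ∨ s = -1) ∧ q s) ∧ ∀ s : ℤ, (s = 1 ∨ s = -1) → ∀ x : ℝ × ℝ,
      0 < (s : ℝ) * disc x.1 x.2 → (x ∈ S ↔ q s) := by
  rcases hS with rfl | rfl | rfl
  · refine ⟨fun s => s = 1, ⟨1, Or.inl rfl, rfl⟩, ?_⟩
    rintro s (rfl | rfl) x hx
    · simpa using hx
    · norm_num at hx ⊢; exact hx.le
  · refine ⟨fun s => s = -1, ⟨-1, Or.inr rfl, rfl⟩, ?_⟩
    rintro s (rfl | rfl) x hx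
    · norm_num at hx ⊢; exact hx.le
    · simpa using hx
  · refine ⟨fun _ => True, ⟨1, Or.inl rfl, trivial⟩, ?_⟩
    intro s _ x hx
    simp only [Set.mem_ofPred_eq, iff_true]
    rintro h
    simp [h] at hx

/-! ### Areas of the regions of given sign. -/

/-- The part of the plane of height less than `X` in which the discriminant has the sign `s`. -/
def signRegion (s : ℤ) (X : ℝ) : Set (ℝ × ℝ) :=
  {x | 0 < (s : ℝ) * disc x.1 x.2 ∧ heightIJ x.1 x.2 < X}

theorem continuous_disc : Continuous fun x : ℝ × ℝ => disc x.1 x.2 := by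
  unfold disc; fun_prop

theorem continuous_heightIJ : Continuous fun x : ℝ × ℝ => heightIJ x.1 x.2 := by
  unfold heightIJ; fun_prop

theorem measurableSet_signRegion (s : ℤ) (X : ℝ) : MeasurableSet (signRegion s X) :=
  ((isOpen_lt continuous_const (continuous_const.mul continuous_disc)).inter
    (isOpen_lt continuous_heightIJ continuous_const)).measurableSet

theorem heightIJ_lt_iff (x : ℝ × ℝ) (X : ℝ) :
    heightIJ x.1 x.2 < X ↔ |x.1| < 3 * X ∧ |x.2| < 27 * X := by
  rw [heightIJ, max_lt_iff, div_lt_iff₀ (by norm_num), div_lt_iff₀ (by norm_num), mul_comm X,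
    mul_comm X]

theorem volume_real_rectangle {a b c d : ℝ} (hab : a ≤ b) (hcd : c ≤ d) :
    (volume : Measure (ℝ × ℝ)).real (Set.Ioo a b ×ˢ Set.Ioo c d) = (b - a) * (d - c) := by
  rw [Measure.volume_eq_prod, measureReal_prod_prod, Real.volume_real_Ioo_of_le hab,
    Real.volume_real_Ioo_of_le hcd]

theorem volume_rectangle_ne_top {a b c d : ℝ} :
    (volume : Measure (ℝ × ℝ)) (Set.Ioo a b ×ˢ Set.Ioo c d) ≠ ⊤ := by
  rw [Measure.volume_eq_prod, Measure.prod_prod]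
  exact ENNReal.mul_ne_top (by simp) (by simp)

theorem signRegion_subset_rectangle (s : ℤ) (X : ℝ) :
    signRegion s X ⊆ Set.Ioo (-(3 * X)) (3 * X) ×ˢ Set.Ioo (-(27 * X)) (27 * X) := by
  rintro x ⟨-, hx⟩
  rw [heightIJ_lt_iff, abs_lt, abs_lt] at hx
  exact ⟨hx.1, hx.2⟩

theorem volume_signRegion_ne_top (s : ℤ) (X : ℝ) :
    (volume : Measure (ℝ × ℝ)) (signRegion s X) ≠ ⊤ :=
  measure_ne_top_of_subset (signRegion_subset_rectangle s X) volume_rectangle_ne_top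

theorem sign_mul_disc_pos_iff_real (s : ℝ) (x : ℝ × ℝ) :
    0 < s * disc x.1 x.2 ↔ 0 < s * (4 * x.1 ^ 3 - x.2 ^ 2) := by
  rw [disc, ← mul_div_assoc, div_pos_iff_of_pos_right (by norm_num)]

/-- Once 729 ≤ 4δ³X, 4(δX)³ exceeds or equals (27X)², the bound for J². So the sign of Δ can differ
from that of I only in the strip 0 ≤ I ≤ δX, and the region lies between two rectangles. -/
theorem sign_rectangles_sandwich {δ X : ℝ} (hδ : 0 < δ) (hδ1 : δ ≤ 1) (hX : 0 < X)
    (h : 729 ≤ 4 * δ ^ 3 * X) {s : ℤ} (hs : s = 1 ∨ s = -1) :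
    ∃ a b a' b' : ℝ, a ≤ b ∧ a' ≤ b' ∧ b - a = (3 - δ) * X ∧ b' - a' = (3 + δ) * X ∧
      Set.Ioo a b ×ˢ Set.Ioo (-(27 * X)) (27 * X) ⊆ signRegion s X ∧
      signRegion s X ⊆ Set.Ioo a' b' ×ˢ Set.Ioo (-(27 * X)) (27 * X) := by
  have hδX : 0 < δ * X := by positivity
  have hδX1 : δ * X ≤ X := by nlinarith
  have hbig : (27 * X) ^ 2 ≤ 4 * (δ * X) ^ 3 := by
    have := mul_le_mul_of_nonneg_right h (by positivity : 0 ≤ X ^ 2)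
    linarith [mul_pow δ X 3]
  have hsq : ∀ y : ℝ, -(27 * X) < y → y < 27 * X → y ^ 2 < (27 * X) ^ 2 := fun y h1 h2 =>
    sq_lt_sq' h1 h2
  rcases hs with rfl | rfl
  · refine ⟨δ * X, 3 * X, -(δ * X), 3 * X, by linarith, by linarith, by ring, by ring, ?_, ?_⟩
    · rintro ⟨x, y⟩ ⟨⟨hx1, hx2⟩, hy1, hy2⟩
      simp only at hx1 hx2 hy1 hy2
      refine ⟨(sign_mul_disc_pos_iff_real _ _).2 ?_, (heightIJ_lt_iff (x, y) X).2
        ⟨abs_lt.2 ⟨by linarith, hx2⟩, abs_lt.2 ⟨hy1, hy2⟩⟩⟩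
      have h1 : (δ * X) ^ 3 < x ^ 3 := by gcongr
      have := hsq y hy1 hy2
      push_cast
      linarith
    · intro z hz
      have hz2 := signRegion_subset_rectangle 1 X hz
      have hz1 := (sign_mul_disc_pos_iff_real _ _).1 hz.1
      refine ⟨⟨?_, hz2.1.2⟩, hz2.2⟩
      by_contra! hle
      have h1 : z.1 < 0 := by linarith
      have h2 : z.1 ^ 3 < 0 := Odd.pow_neg (by decide) h1
      push_cast at hz1
      linarith [sq_nonneg z.2]
  · refine ⟨-(3 * X), -(δ * X), -(3 * X), δ * X, by linarith, by linarith, by ring, by ring, ?_, ?_⟩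
    · rintro ⟨x, y⟩ ⟨⟨hx1, hx2⟩, hy1, hy2⟩
      simp only at hx1 hx2 hy1 hy2
      refine ⟨(sign_mul_disc_pos_iff_real _ _).2 ?_, (heightIJ_lt_iff (x, y) X).2
        ⟨abs_lt.2 ⟨hx1, by linarith⟩, abs_lt.2 ⟨hy1, hy2⟩⟩⟩
      have h2 : x ^ 3 < 0 := Odd.pow_neg (by decide) (by linarith)
      push_cast
      linarith [sq_nonneg y]
    · intro z hz
      have hz2 := signRegion_subset_rectangle (-1) X hz
      have hz1 := (sign_mul_disc_pos_iff_real _ _).1 hz.1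
      refine ⟨⟨hz2.1.1, ?_⟩, hz2.2⟩
      by_contra! hle
      have h1 : (δ * X) ^ 3 ≤ z.1 ^ 3 := by gcongr
      have := hsq z.2 hz2.2.1 hz2.2.2
      push_cast at hz1
      linarith

theorem tendsto_volume_signRegion {s : ℤ} (hs : s = 1 ∨ s = -1) :
    Tendsto (fun X => (volume : Measure (ℝ × ℝ)).real (signRegion s X) / X ^ 2) atTop (𝓝 162) := by
  rw [Metric.tendsto_atTop']
  intro ε hε
  -- The strip of width δX and height 54X contributes 54δ after division by X²; 55 makes the final
  -- inequality strict.
  set δ : ℝ := min 1 (ε / 55) with hδdef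
  have hδ : 0 < δ := lt_min one_pos (by positivity)
  have hδε : δ ≤ ε / 55 := min_le_right _ _
  refine ⟨max 1 (729 / (4 * δ ^ 3)), fun X hX => ?_⟩
  have hX0 : 0 < X := one_pos.trans ((le_max_left _ _).trans_lt hX)
  have hXδ : 729 ≤ 4 * δ ^ 3 * X := by
    have := ((le_max_right _ _).trans_lt hX).le
    rw [div_le_iff₀ (by positivity)] at this
    linarith
  obtain ⟨a, b, a', b', hab, hab', e, e', h1, h2⟩ :=
    sign_rectangles_sandwich hδ (min_le_left _ _) hX0 hXδ hs
  have h1' := measureReal_mono h1 (volume_signRegion_ne_top s X)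
  have h2' := measureReal_mono h2 volume_rectangle_ne_top
  rw [volume_real_rectangle hab (by linarith), e] at h1'
  rw [volume_real_rectangle hab' (by linarith), e'] at h2'
  have hl : 162 - 54 * δ ≤ (volume : Measure (ℝ × ℝ)).real (signRegion s X) / X ^ 2 := by
    rw [le_div_iff₀ (by positivity)]
    linarith
  have hu : (volume : Measure (ℝ × ℝ)).real (signRegion s X) / X ^ 2 ≤ 162 + 54 * δ := by
    rw [div_le_iff₀ (by positivity)]
    linarith
  rw [Real.dist_eq, abs_lt]
  constructor <;> linarith

/-! ### Largeness, and existence of points when the product is positive. -/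

/-- This is largeness read backwards: for all but finitely many p, a point outside W_p is outside
Inv_p(F), so p² ∣ Δ. It supplies the hypothesis of the sieve. -/
theorem exists_forall_large_sq_dvd {F : Set EllCurve} (hF : IsLargeFamily F)
    {W : ∀ p : Nat.Primes, Set (ℤ_[p] × ℤ_[p])} (hW : ∀ p : Nat.Primes, invAt p F ⊆ W p) :
    ∃ p₀ : ℕ, ∀ p : Nat.Primes, p₀ < p → ∀ z : ℤ × ℤ, intPair p z ∉ W p →
      ((p : ℕ) : ℤ) ^ 2 ∣ 4 * z.1 ^ 3 - z.2 ^ 2 := by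
  have hfin := eventually_cofinite.1 hF.large
  refine ⟨hfin.toFinset.sup fun p => (p : ℕ), fun p hp z hz => ?_⟩
  by_contra hdvd
  have hp' : p ∉ hfin.toFinset := fun h =>
    absurd (Finset.le_sup (f := fun p : Nat.Primes => (p : ℕ)) h) (not_le.2 hp)
  rw [Set.Finite.mem_toFinset, Set.mem_ofPred_eq, not_not] at hp'
  refine hz (hW p (hp' _ ?_))
  rintro ⟨d, hd⟩
  exact hdvd (sq_dvd_of_padicDisc_eq hd)

/-- Replacing one of the factors by a positive number `≤ 1` keeps the product positive. -/
theorem tprod_pos_of_forall_ne {ι : Type*} {f g : ι → ℝ} (i : ι) (hf0 : ∀ j, 0 ≤ f j)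
    (hf1 : ∀ j, f j ≤ 1) (hg1 : ∀ j, g j ≤ 1) (hgi : 0 < g i)
    (h : ∀ j, j ≠ i → g j = f j) (hpos : 0 < ∏' j, f j) : 0 < ∏' j, g j := by
  classical
  have hg0 : ∀ j, 0 ≤ g j := fun j => by
    by_cases hj : j = i
    · rw [hj]; exact hgi.le
    · rw [h j hj]; exact hf0 j
  have hf := (hasProd_of_mem_unitInterval hf0 hf1).multipliable.hasProd
  have hg := (hasProd_of_mem_unitInterval hg0 hg1).multipliable.hasProd
  simp only [HasProd, SummationFilter.unconditional_filter] at hf hg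
  -- Every finite product of g is at least `g i` times the corresponding product of f, since all
  -- factors are at most 1.
  refine (mul_pos hgi hpos).trans_le (le_of_tendsto_of_tendsto' (hf.const_mul (g i)) hg fun s => ?_)
  have hle : ∀ j, g i * f j ≤ f j := fun j => mul_le_of_le_one_left (hf0 j) (hg1 i)
  by_cases hi : i ∈ s
  · rw [← Finset.mul_prod_erase s f hi, ← Finset.mul_prod_erase s g hi]
    have e : ∏ j ∈ s.erase i, g j = ∏ j ∈ s.erase i, f j :=
      Finset.prod_congr rfl fun j hj => h j (Finset.ne_of_mem_erase hj)
    rw [e, ← mul_assoc]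
    exact mul_le_mul_of_nonneg_right (mul_le_of_le_one_right hgi.le (hf1 i))
      (Finset.prod_nonneg fun j _ => hf0 j)
  · have e : ∏ j ∈ s, g j = ∏ j ∈ s, f j :=
      Finset.prod_congr rfl fun j hj => h j fun hji => hi (hji ▸ hj)
    rw [e]
    exact mul_le_of_le_one_left (Finset.prod_nonneg fun j _ => hf0 j) (hg1 i)

/-- A set of positive density is not empty; this is how the sieve produces global points from local
conditions. -/
theorem exists_mem_signBox {s : ℤ} (hs : s = 1 ∨ s = -1)
    {W : ∀ p : Nat.Primes, Set (ℤ_[p] × ℤ_[p])}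
    (hW : ∀ p : Nat.Primes, padicPlaneMeasure p (frontier (W p)) = 0) {p₀ : ℕ}
    (hlarge : ∀ p : Nat.Primes, p₀ < p → ∀ z : ℤ × ℤ, intPair p z ∉ W p →
      ((p : ℕ) : ℤ) ^ 2 ∣ 4 * z.1 ^ 3 - z.2 ^ 2)
    (hpos : 0 < ∏' p : Nat.Primes, (padicPlaneMeasure p).real (W p)) :
    ∃ z : ℤ × ℤ, 0 < s * (4 * z.1 ^ 3 - z.2 ^ 2) ∧ ∀ p : Nat.Primes, intPair p z ∈ W p := by
  have h := tendsto_pointDensity_signBox hs hW hlarge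
  obtain ⟨X, hX⟩ := (h.eventually (lt_mem_nhds (by positivity))).exists
  by_contra hno
  refine hX.ne' ?_
  classical
  unfold pointDensity
  rw [Finset.filter_false_of_mem, Finset.card_empty, Nat.cast_zero, zero_div]
  exact fun z hz hzW => hno ⟨z, (Finset.mem_filter.1 hz).2, hzW⟩

/-! ### Local masses and counting for a large family. -/

section Family

variable {F : Set EllCurve} {S : ∀ p : Nat.Primes, Set (ℤ_[p] × ℤ_[p])} {q : ℤ → Prop}

/-- The conditions on `(I(E), J(E))` at all primes and at infinity that define `F`. -/
structure IsDefinedBy (F : Set EllCurve) (S : ∀ p : Nat.Primes, Set (ℤ_[p] × ℤ_[p]))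
    (q : ℤ → Prop) : Prop where
  isLocal : ∀ p : Nat.Primes, IsLocalCondition p (S p)
  exists_sign : ∃ s : ℤ, (s = 1 ∨ s = -1) ∧ q s
  mem_iff : ∀ s : ℤ, (s = 1 ∨ s = -1) → ∀ E : EllCurve, 0 < s * (4 * E.I ^ 3 - E.J ^ 2) →
    (E ∈ F ↔ (∀ p : Nat.Primes, E.padicInv p ∈ S p) ∧ q s)

theorem IsCongruenceFamily.exists_isDefinedBy (hF : IsCongruenceFamily F) :
    ∃ (S : ∀ p : Nat.Primes, Set (ℤ_[p] × ℤ_[p])) (q : ℤ → Prop), IsDefinedBy F S q := by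
  obtain ⟨S, Sinf, hS, hSinf, rfl⟩ := hF
  obtain ⟨q, hq, h⟩ := hSinf.exists_sign
  refine ⟨S, q, hS, hq, fun s hs E hE => and_congr_right fun _ => ?_⟩
  exact h s hs E.realInv ((sign_mul_disc_pos_iff s E.I E.J).2 hE)

theorem EllCurve.exists_sign (E : EllCurve) :
    ∃ s : ℤ, (s = 1 ∨ s = -1) ∧ 0 < s * (4 * E.I ^ 3 - E.J ^ 2) := by
  rcases lt_or_gt_of_ne E.disc_ne_zero with h | h
  · exact ⟨-1, Or.inr rfl, by linarith⟩
  · exact ⟨1, Or.inl rfl, by linarith⟩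

/-- The local conditions including minimality. -/
def minimalCondition (S : ∀ p : Nat.Primes, Set (ℤ_[p] × ℤ_[p])) (p : Nat.Primes) :
    Set (ℤ_[p] × ℤ_[p]) := S p ∩ minimalPairs p

theorem IsDefinedBy.padicInv_mem (h : IsDefinedBy F S q) {E : EllCurve} (hE : E ∈ F)
    (p : Nat.Primes) : E.padicInv p ∈ minimalCondition S p := by
  obtain ⟨s, hs, hsE⟩ := E.exists_sign
  exact ⟨((h.mem_iff s hs E hsE).1 hE).1 p, E.padicInv_mem_minimalPairs p⟩

theorem IsDefinedBy.invAt_subset (h : IsDefinedBy F S q) (p : Nat.Primes) :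
    invAt p F ⊆ minimalCondition S p :=
  LargeFamily.invAt_subset (h.isLocal p) fun _ hE => h.padicInv_mem hE p

theorem IsDefinedBy.frontier_null (h : IsDefinedBy F S q) (p : Nat.Primes) :
    padicPlaneMeasure p (frontier (minimalCondition S p)) = 0 :=
  frontier_inter_minimalPairs_null (h.isLocal p)

theorem IsDefinedBy.exists_mem (h : IsDefinedBy F S q) {s : ℤ} (hs : s = 1 ∨ s = -1) (hq : q s)
    {z : ℤ × ℤ} (hz : 0 < s * (4 * z.1 ^ 3 - z.2 ^ 2))
    (hzS : ∀ p : Nat.Primes, intPair p z ∈ minimalCondition S p) :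
    ∃ E ∈ F, (E.I, E.J) = z := by
  obtain ⟨E, rfl⟩ := exists_ellCurve_of_forall_mem h.isLocal hzS
  exact ⟨E, (h.mem_iff s hs E hz).2 ⟨fun p => (hzS p).1, hq⟩, rfl⟩

/-- If the product of the local densities is positive, then interior points of a local condition
are limits of points of the family. -/
theorem IsDefinedBy.interior_subset_invAt (h : IsDefinedBy F S q) (hF : IsLargeFamily F)
    (hpos : 0 < ∏' p : Nat.Primes, (padicPlaneMeasure p).real (minimalCondition S p))
    (p : Nat.Primes) : interior (minimalCondition S p) ⊆ invAt p F := by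
  classical
  intro x hx
  refine ⟨?_, (h.isLocal p).disc_ne_zero x (interior_subset hx).1⟩
  rw [Metric.mem_closure_iff]
  intro ε hε
  obtain ⟨η, hη, hball⟩ := Metric.isOpen_iff.1 isOpen_interior x hx
  obtain ⟨k, hk⟩ := PadicInt.exists_pow_neg_lt p (lt_min hε hη)
  set V : Set (ℤ_[p] × ℤ_[p]) := {y | reduction p k y = reduction p k x} with hV
  have hdist : ∀ y ∈ V, dist y x < min ε η := fun y hy =>
    ((reduction_eq_iff p k y x).1 hy).trans_lt hk
  have hVW : V ⊆ minimalCondition S p := fun y hy =>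
    interior_subset (hball (Metric.mem_ball.2 ((hdist y hy).trans_le (min_le_right _ _))))
  -- The condition at p is replaced by a small disc V around x. Its measure is positive, so the
  -- product stays positive and the sieve finds a curve of F in V.
  set W : ∀ r : Nat.Primes, Set (ℤ_[r] × ℤ_[r]) := Function.update (minimalCondition S) p V with hW
  have hWp : W p = V := Function.update_self _ _ _
  have hWne : ∀ r, r ≠ p → W r = minimalCondition S r := fun r hr => Function.update_of_ne hr _ _
  have hWsub : ∀ r, W r ⊆ minimalCondition S r := fun r => by
    by_cases hr : r = p
    · subst hr; rw [hWp]; exact hVW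
    · rw [hWne r hr]
  have hWnull : ∀ r : Nat.Primes, padicPlaneMeasure r (frontier (W r)) = 0 := fun r => by
    by_cases hr : r = p
    · subst hr
      rw [hWp, (isClopen_reduction_fiber r k _).frontier_eq, measure_empty]
    · rw [hWne r hr]; exact h.frontier_null r
  obtain ⟨p₀, hp₀⟩ := exists_forall_large_sq_dvd hF h.invAt_subset
  have hlarge : ∀ r : Nat.Primes, max p₀ p < r → ∀ z : ℤ × ℤ, intPair r z ∉ W r →
      ((r : ℕ) : ℤ) ^ 2 ∣ 4 * z.1 ^ 3 - z.2 ^ 2 := by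
    intro r hr z hz
    have hrp : r ≠ p := by
      rintro rfl; exact absurd ((le_max_right _ _).trans_lt hr) (lt_irrefl _)
    rw [hWne r hrp] at hz
    exact hp₀ r ((le_max_left _ _).trans_lt hr) z hz
  have hpos' : 0 < ∏' r : Nat.Primes, (padicPlaneMeasure r).real (W r) := by
    refine tprod_pos_of_forall_ne p (fun _ => measureReal_nonneg) (fun _ => measureReal_le_one)
      (fun _ => measureReal_le_one) ?_ (fun r hr => by rw [hWne r hr]) hpos
    rw [hWp, hV, measureReal_reduction_fiber]
    have := p.2.pos
    positivity
  obtain ⟨s, hs, hq⟩ := h.exists_sign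
  obtain ⟨z, hz, hzW⟩ := exists_mem_signBox hs hWnull hlarge hpos'
  obtain ⟨E, hE, rfl⟩ := h.exists_mem hs hq hz fun r => hWsub r (hzW r)
  refine ⟨_, ⟨E, hE, rfl⟩, ?_⟩
  have hEV := hzW p
  rw [hWp] at hEV
  rw [dist_comm]
  exact (hdist _ hEV).trans_le (min_le_left _ _)

/-- If the right side is zero, comparison makes the left side zero, although individual factors may
differ. If it is positive, Inv_p(F) lies between the interior of the local condition and the
condition itself, which differ by a null set. -/
theorem IsDefinedBy.tprod_localMass (h : IsDefinedBy F S q) (hF : IsLargeFamily F) :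
    ∏' p : Nat.Primes, localMass p F =
      ∏' p : Nat.Primes, (padicPlaneMeasure p).real (minimalCondition S p) := by
  have hle : ∀ p : Nat.Primes,
      localMass p F ≤ (padicPlaneMeasure p).real (minimalCondition S p) := fun p =>
    measureReal_mono (h.invAt_subset p) (measure_ne_top _ _)
  have h1 := (multipliable_measureReal fun p : Nat.Primes => invAt p F).hasProd
  have h2 := (multipliable_measureReal (minimalCondition S)).hasProd
  simp only [HasProd, SummationFilter.unconditional_filter] at h1 h2
  have hd : 0 ≤ ∏' p : Nat.Primes, (padicPlaneMeasure p).real (minimalCondition S p) :=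
    ge_of_tendsto' h2 fun s => Finset.prod_nonneg fun _ _ => measureReal_nonneg
  rcases hd.eq_or_lt with h0 | hpos
  · rw [← h0]
    refine le_antisymm ?_ (ge_of_tendsto' h1 fun s => Finset.prod_nonneg fun _ _ =>
      measureReal_nonneg)
    rw [h0]
    exact le_of_tendsto_of_tendsto' h1 h2 fun s =>
      Finset.prod_le_prod (fun _ _ => measureReal_nonneg) fun p _ => hle p
  · congr 1
    ext p
    refine le_antisymm (hle p) ?_
    have e : (padicPlaneMeasure p).real (interior (minimalCondition S p)) =
        (padicPlaneMeasure p).real (minimalCondition S p) :=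
      measureReal_congr (interior_ae_eq_of_null_frontier (h.frontier_null p))
    rw [← e]
    exact measureReal_mono (h.interior_subset_invAt hF hpos p) (measure_ne_top _ _)

/-- The number of curves in the family of bounded height and given sign of the discriminant. -/
noncomputable def signCount (F : Set EllCurve) (s : ℤ) (X : ℝ) : ℕ :=
  {E ∈ F | E.height < X ∧ 0 < s * (4 * E.I ^ 3 - E.J ^ 2)}.ncard

theorem count_eq_signCount_add (F : Set EllCurve) (X : ℝ) :
    count F X = signCount F 1 X + signCount F (-1) X := by
  unfold count signCount
  rw [← Set.ncard_union_eq ?_ ((finite_height_lt F X).subset fun E hE => ⟨hE.1, hE.2.1⟩)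
    ((finite_height_lt F X).subset fun E hE => ⟨hE.1, hE.2.1⟩)]
  · congr 1
    ext E
    simp only [Set.mem_union, Set.mem_ofPred_eq]
    refine ⟨fun hE => ?_, by tauto⟩
    obtain ⟨s, rfl | rfl, hs⟩ := E.exists_sign <;> tauto
  · refine Set.disjoint_left.2 fun E hE hE' => ?_
    have h1 := hE.2.2
    have h2 := hE'.2.2
    linarith

theorem IsDefinedBy.signCount_eq (h : IsDefinedBy F S q) {s : ℤ} (hs : s = 1 ∨ s = -1)
    (hq : q s) (X : ℝ) : (signCount F s X : ℝ) / X ^ 2 =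
      pointDensity (signBox s) {z | ∀ p : Nat.Primes, intPair p z ∈ minimalCondition S p} X := by
  classical
  unfold signCount pointDensity
  congr 2
  rw [← Set.ncard_image_of_injective _ injective_I_J, ← Set.ncard_coe_finset]
  congr 1
  ext z
  simp only [Set.mem_image, Set.mem_ofPred_eq, Finset.coe_filter, signBox, Finset.mem_filter]
  constructor
  · rintro ⟨E, ⟨hE, hX, hpos⟩, rfl⟩
    exact ⟨⟨(E.height_lt_iff X).1 hX, hpos⟩, fun p => h.padicInv_mem hE p⟩
  · rintro ⟨⟨hX, hpos⟩, hz⟩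
    obtain ⟨E, hE, rfl⟩ := h.exists_mem hs hq hpos hz
    exact ⟨E, ⟨hE, (E.height_lt_iff X).2 hX, hpos⟩, rfl⟩

theorem IsDefinedBy.signCount_eq_zero (h : IsDefinedBy F S q) {s : ℤ} (hs : s = 1 ∨ s = -1)
    (hq : ¬ q s) (X : ℝ) : signCount F s X = 0 := by
  unfold signCount
  rw [Set.ncard_eq_zero ((finite_height_lt F X).subset fun E hE => ⟨hE.1, hE.2.1⟩)]
  refine Set.eq_empty_of_forall_notMem fun E hE => hq ?_
  exact ((h.mem_iff s hs E hE.2.2).1 hE.1).2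

/-- The area of the part of `Inv_∞(F)` of bounded height and given sign of the discriminant. -/
noncomputable def signMass (F : Set EllCurve) (s : ℤ) (X : ℝ) : ℝ :=
  (volume : Measure (ℝ × ℝ)).real
    {x | x ∈ signRegion s X ∧ ∃ E ∈ F, 0 < s * (4 * E.I ^ 3 - E.J ^ 2)}

theorem massInfinity_eq_signMass_add (F : Set EllCurve) (X : ℝ) :
    massInfinity F X = signMass F 1 X + signMass F (-1) X := by
  unfold massInfinity signMass
  have hmeas : MeasurableSet
      {x | x ∈ signRegion (-1) X ∧ ∃ E ∈ F, 0 < -1 * (4 * E.I ^ 3 - E.J ^ 2)} :=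
    (measurableSet_signRegion (-1) X).inter (MeasurableSet.const _)
  rw [← measureReal_union ?_ hmeas
    (measure_ne_top_of_subset (fun x hx => hx.1) (volume_signRegion_ne_top 1 X))
    (measure_ne_top_of_subset (fun x hx => hx.1) (volume_signRegion_ne_top (-1) X))]
  · congr 1
    ext x
    have h1 : ∀ E : EllCurve, 0 < disc (E.I : ℝ) (E.J : ℝ) ↔ 0 < 1 * (4 * E.I ^ 3 - E.J ^ 2) :=
      fun E => by rw [← sign_mul_disc_pos_iff]; norm_num
    have h2 : ∀ E : EllCurve, disc (E.I : ℝ) (E.J : ℝ) < 0 ↔ 0 < -1 * (4 * E.I ^ 3 - E.J ^ 2) :=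
      fun E => by rw [← sign_mul_disc_pos_iff]; norm_num
    simp only [invInfinity, signRegion, Set.mem_union, Set.mem_ofPred_eq, h1, h2, Int.cast_one,
      one_mul, Int.cast_neg, neg_mul, Left.neg_pos_iff]
    have key : ∀ a b c d e : Prop, (a ∧ b ∨ c ∧ d) ∧ e ↔ (a ∧ e) ∧ b ∨ (c ∧ e) ∧ d := by tauto
    exact key _ _ _ _ _
  · refine Set.disjoint_left.2 fun x hx hx' => ?_
    have h1 := hx.1.1
    have h2 := hx'.1.1
    push_cast at h1 h2
    linarith

theorem signMass_eq {s : ℤ} (hs : ∃ E ∈ F, 0 < s * (4 * E.I ^ 3 - E.J ^ 2)) (X : ℝ) :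
    signMass F s X = (volume : Measure (ℝ × ℝ)).real (signRegion s X) := by
  unfold signMass
  simp only [hs, and_true, Set.ofPred_mem_eq]

theorem signMass_eq_zero {s : ℤ} (hs : ¬ ∃ E ∈ F, 0 < s * (4 * E.I ^ 3 - E.J ^ 2)) (X : ℝ) :
    signMass F s X = 0 := by
  unfold signMass
  simp [hs]

/-- The asymptotic count for each sign of the discriminant. -/
theorem IsDefinedBy.tendsto_sign (h : IsDefinedBy F S q) (hF : IsLargeFamily F) {s : ℤ}
    (hs : s = 1 ∨ s = -1) :
    Tendsto (fun X => ((signCount F s X : ℝ) -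
      signMass F s X * ∏' p : Nat.Primes, localMass p F) / X ^ 2) atTop (𝓝 0) := by
  obtain ⟨p₀, hp₀⟩ := exists_forall_large_sq_dvd hF h.invAt_subset
  rw [h.tprod_localMass hF]
  set d := ∏' p : Nat.Primes, (padicPlaneMeasure p).real (minimalCondition S p) with hd
  have hd0 : 0 ≤ d := by
    have h2 := (multipliable_measureReal (minimalCondition S)).hasProd
    simp only [HasProd, SummationFilter.unconditional_filter] at h2
    exact ge_of_tendsto' h2 fun s => Finset.prod_nonneg fun _ _ => measureReal_nonneg
  have hcount := tendsto_pointDensity_signBox hs h.frontier_null hp₀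
  rw [← hd] at hcount
  by_cases hq : q s
  · have hcount' : Tendsto (fun X => (signCount F s X : ℝ) / X ^ 2) atTop (𝓝 (162 * d)) :=
      hcount.congr fun X => (h.signCount_eq hs hq X).symm
    -- For d = 0 the area term vanishes whether or not F contains a curve of sign s. For d > 0 such
    -- a curve exists, so the whole region of sign s belongs to Inv_∞(F).
    rcases hd0.eq_or_lt with h0 | hpos
    · rw [← h0] at hcount' ⊢
      simpa using hcount'
    · obtain ⟨z, hz, hzW⟩ := exists_mem_signBox hs h.frontier_null hp₀ hpos
      obtain ⟨E, hE, rfl⟩ := h.exists_mem hs hq hz hzW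
      have key := hcount'.sub ((tendsto_volume_signRegion hs).mul_const d)
      rw [sub_self] at key
      refine key.congr fun X => ?_
      rw [signMass_eq ⟨E, hE, hz⟩]
      ring
  · have hno : ¬ ∃ E ∈ F, 0 < s * (4 * E.I ^ 3 - E.J ^ 2) := by
      rintro ⟨E, hE, hpos⟩
      exact hq ((h.mem_iff s hs E hpos).1 hE).2
    simp [h.signCount_eq_zero hs hq, signMass_eq_zero hno]

end Family

end LargeFamily

theorem mainTheorem9 (F : Set LargeFamily.EllCurve) (hF : LargeFamily.IsLargeFamily F) :
    Multipliable (fun p : Nat.Primes => LargeFamily.localMass p F) ∧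
    (fun X : ℝ => (LargeFamily.count F X : ℝ) -
        LargeFamily.massInfinity F X * ∏' p : Nat.Primes, LargeFamily.localMass p F)
      =o[atTop] (fun X : ℝ => X ^ 2) := by
  obtain ⟨S, q, h⟩ := hF.congruence.exists_isDefinedBy
  refine ⟨LargeFamily.multipliable_measureReal fun p => LargeFamily.invAt p F, ?_⟩
  refine (isLittleO_iff_tendsto' ?_).2 ?_
  · filter_upwards [eventually_gt_atTop 0] with X hX h0
    exact absurd h0 (by positivity)
  · have key := (h.tendsto_sign hF (Or.inl rfl)).add (h.tendsto_sign hF (Or.inr rfl))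
    rw [add_zero] at key
    refine key.congr fun X => ?_
    rw [LargeFamily.count_eq_signCount_add, LargeFamily.massInfinity_eq_signMass_add]
    push_cast
    ring
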